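/- **Setting.** Let $X$ be an at most countable set, $\mu$ a positive measure on $2^X$ with $\mu(x):=\mu(\{x\})\in(0,\infty)$ for all $x\in X$, and $T:X\to X$ a map such that the Radon–Nikodym derivative $h_T$ of $\mu\circ T^{-1}$ with respect to $\mu$ belongs to $L^\infty(\mu)$. Put $\lambda_v=\sqrt{\mu(v)}/\sqrt{\mu(Tv)}$ for $v\in X$, and let $S$ be the bounded operator on the complex Hilbert space $\ell^2(X)$, with standard orthonormal basis $(e_v)_{v\in X}$, such that $Se_u=\sum_{Tv=u}\lambda_v e_v$ for $u\in X$. The operator $S$ is called $m$-isometric if $\sum_{k=0}^m(-1)^{m-k}\binom mk S^{*k}S^k=0$. Let $G_T$ be the directed graph with vertex set $X$ and edges $(Tx,x)$, $x\in X$. Assume that $G_T$ is connected (as an undirected graph) and has the following form: for some $\kappa\ge1$ there are distinct vertices $v_0,\dots,v_{\kappa-1}$ such that $(v_j,v_{j+1})$, $0\le j\le\kappa-2$, and $(v_{\kappa-1},v_0)$ are edges of $G_T$, and there is a partition $\mathcal R$ of $X\setminus\{v_0,\dots,v_{\kappa-1}\}$ such that, for every $R\in\mathcal R$, the subgraph of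 $G_T$ induced on $R$ is a directed tree (connected, without directed cycles, all in-degrees at most $1$) with a root $\omega_R$ (a vertex of in-degree $0$ in the subgraph), and there is exactly one $i_R\in\{0,\dots,\kappa-1\}$ for which $(v_{i_R},\omega_R)$ is an edge of $G_T$. Put $\Lambda_{0,i}=\prod_{j=1}^{i}\lambda_{v_{j\bmod\kappa}}$. For $m\ge2$ let $A_{m,\kappa}$ be the real $m\times m$ matrix whose $r$-th row, $1\le r\le m-1$, is $$(d_{1,r},\,d_{2,r-1},\,\dots,\,d_{r,1},\,0,\dots,0),\qquad d_{i,j}=\binom{m-i}{m-j-i}\kappa^j,$$ and whose $m$-th row is $(0,\dots,0,1)$. If $\kappa>1$, let $B_{m,\kappa}$ be the $(\kappa-1)\times m$ matrix whose $r$-th row is $(r^{m-1},r^{m-2},\dots,r^0)$, $1\le r\le\kappa-1$. Let $\mathbb R_d[x]$ denote the set of real polynomials of degree at most $d$. A polynomial $p_v\in\mathbb R[x]$ is said to represent the vertex $v$ if $p_v(n)=\|S^ne_v\|^2$ for all $n\in\mathbb N=\{0,1,2,\dots\}$. **Theorem.** Let $m\ge2$. If every vertex $v\notin\{v_0,\dots,v_{\kappa-1}\}$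 is represented by a polynomial $p_v\in\mathbb R_{m-2}[x]$, then the formula $$q(x)=\sum_{i=0}^{\kappa-1}\Lambda_{0,i}^2\sum_{R\in\mathcal R,\ i_R=i}\lambda_{\omega_R}^2\,p_{\omega_R}(x+\kappa-i-1),\qquad x\in\mathbb R,$$ in which the series converge, defines a polynomial $q(x)=\sum_{i=0}^{m-2}b_ix^i\in\mathbb R_{m-2}[x]$. The following conditions are equivalent: (i) $S$ is $m$-isometric; (ii) every vertex $v\notin\{v_0,\dots,v_{\kappa-1}\}$ is represented by a unique polynomial $p_v\in\mathbb R_{m-2}[x]$, and, if $\kappa>1$, $$m=\operatorname{rank}\begin{bmatrix}A_{m,\kappa}&b\end{bmatrix}=\operatorname{rank}\begin{bmatrix}A_{m,\kappa}&b\\ B_{m,\kappa}&a\end{bmatrix},$$ where $b=(b_{m-2},b_{m-3},\dots,b_0,1)^{T}$ is formed from the coefficients of the above $q$, and $a=(a_1,\dots,a_{\kappa-1})^{T}$ with $a_i=\|S^ie_{v_0}\|^2$. Moreover, if (ii) holds, then the system $A_{m,\kappa}c=b$ has exactly one solution $c=(c_{m-1},\dots,c_0)^T\in\mathbb R^m$,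 and the vertex $v_0$ is represented by the polynomial $p_{v_0}(x)=\sum_{j=0}^{m-1}c_jx^j$. -/

import Mathlib

open MeasureTheory
open scoped ENNReal lp Polynomial

noncomputable section

namespace CompOp

/-! ### Directed graphs -/

section Graphs

variable {W : Type*}

/-- The graph is connected: any two distinct vertices are joined by a finite sequence of vertices,
consecutive ones being the ends of an edge (in either direction). -/
def Connected (G : Digraph W) : Prop :=
  ∀ v w, v ≠ w → Relation.TransGen (fun a b => G.Adj a b ∨ G.Adj b a) v w

/-- The graph has a cycle: a directed path of positive length from a vertex to itself. -/
def HasCycle (G : Digraph W) : Prop :=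
  ∃ v, Relation.TransGen G.Adj v v

/-- A connected graph without cycles in which every vertex has in-degree at most one. -/
structure IsDirectedTree (G : Digraph W) : Prop where
  connected : Connected G
  acyclic : ¬ HasCycle G
  indegree_le_one : ∀ v u u', G.Adj u v → G.Adj u' v → u = u'

/-- A directed tree with root `ω`, i.e. a vertex `ω` of in-degree zero. -/
structure IsRootedDirectedTree (G : Digraph W) (ω : W) : Prop extends IsDirectedTree G where
  indegree_root : ∀ u, ¬ G.Adj u ω

/-- The subgraph with vertex set `R` and all edges of `G` between elements of `R`. -/
def inducedGraph (G : Digraph W) (R : Set W) : Digraph R where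
  Adj a b := G.Adj a b

end Graphs

variable {X : Type*}

/-- The graph of a self-map `T`: the edges are the pairs `(T x, x)`. -/
def selfMapGraph (T : X → X) : Digraph X where
  Adj u v := T v = u

/-- A presentation of the graph of `T` as a cycle `v₀ → v₁ → ⋯ → v_{κ-1} → v₀` together with a
partition of the remaining vertices into rooted directed trees, the root of each of them being a
child of exactly one vertex of the cycle. -/
structure OneCycleGraph (T : X → X) (κ : ℕ) where
  κ_pos : 1 ≤ κ
  /-- the vertices of the cycle -/
  v : Fin κ → X
  v_injective : Function.Injective v
  adj_succ : ∀ (j : ℕ) (h : j + 1 < κ),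
    (selfMapGraph T).Adj (v ⟨j, Nat.lt_of_succ_lt h⟩) (v ⟨j + 1, h⟩)
  adj_last : (selfMapGraph T).Adj (v ⟨κ - 1, Nat.sub_lt κ_pos Nat.one_pos⟩) (v ⟨0, κ_pos⟩)
  /-- the vertex sets of the trees -/
  trees : Set (Set X)
  trees_disjoint : trees.PairwiseDisjoint id
  trees_cover : ⋃₀ trees = (Set.range v)ᶜ
  /-- the root `ω_R` of the tree `R` -/
  root : (R : trees) → (R : Set X)
  isRootedTree : ∀ R : trees,
    IsRootedDirectedTree (inducedGraph (selfMapGraph T) (R : Set X)) (root R)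
  /-- the index `i_R` of the only vertex of the cycle that is the parent of `ω_R` -/
  idx : trees → Fin κ
  adj_root_iff : ∀ (R : trees) (j : Fin κ),
    (selfMapGraph T).Adj (v j) (root R : X) ↔ j = idx R

/-! ### Composition operators as weighted shifts -/

/-- Every point has positive and finite mass. (The space is countable with all subsets measurable,
so this says that it is a discrete measure space.) -/
def IsDiscreteMeasure [MeasurableSpace X] (μ : Measure X) : Prop :=
  ∀ x, 0 < μ {x} ∧ μ {x} < ∞

/-- The Radon-Nikodym derivative `h_T` of `μ ∘ T⁻¹` with respect to `μ`. -/
def hDeriv [MeasurableSpace X] (μ : Measure X) (T : X → X) : X → ℝ≥0∞ :=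
  (μ.map T).rnDeriv μ

/-- `h_T ∈ L^∞(μ)`. -/
def HasBoundedDeriv [MeasurableSpace X] (μ : Measure X) (T : X → X) : Prop :=
  essSup (hDeriv μ T) μ < ∞

/-- The weights `λ_v = √μ(v) / √μ(Tv)`. -/
def weight [MeasurableSpace X] (μ : Measure X) (T : X → X) (v : X) : ℝ :=
  √(μ.real {v}) / √(μ.real {T v})

theorem sum_weighted_le [MeasurableSpace X] {μ : Measure X} {T : X → X} {C : ℝ} (hC : 0 ≤ C) (h : ∀ u, ∀ s : Finset X, (∀ v ∈ s, T v = u) →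
      ∑ v ∈ s, weight μ T v ^ 2 ≤ C) (f : ℓ²(X, ℂ)) (s : Finset X) :
    ∑ v ∈ s, ‖(weight μ T v : ℂ) * f (T v)‖ ^ (2 : ℝ≥0∞).toReal ≤
      (√C * ‖f‖) ^ (2 : ℝ≥0∞).toReal := by
  classical
  have hf := lp.sum_rpow_le_norm_rpow (p := 2) (by norm_num) f (s.image T)
  simp only [ENNReal.toReal_ofNat, Real.rpow_ofNat] at hf ⊢
  rw [mul_pow, Real.sq_sqrt hC,
    ← Finset.sum_fiberwise_of_maps_to (t := s.image T) (g := T)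
      fun v hv => Finset.mem_image_of_mem T hv]
  refine le_trans (Finset.sum_le_sum (g := fun u => C * ‖f u‖ ^ 2) fun u _ => ?_) ?_
  · refine le_trans (le_of_eq ?_)
      (mul_le_mul_of_nonneg_right (h u (s.filter fun v => T v = u) fun v hv =>
        (Finset.mem_filter.1 hv).2) (sq_nonneg ‖f u‖))
    rw [Finset.sum_mul]
    refine Finset.sum_congr rfl fun v hv => ?_
    rw [(Finset.mem_filter.1 hv).2, norm_mul, mul_pow, Complex.norm_real, Real.norm_eq_abs, sq_abs]
  · rw [← Finset.mul_sum]
    exact mul_le_mul_of_nonneg_left hf hC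

section Shift

variable [Countable X] [MeasurableSpace X] [DiscreteMeasurableSpace X]
  {μ : Measure X} {T : X → X}

theorem exists_bound (hμ : IsDiscreteMeasure μ) (hT : HasBoundedDeriv μ T) :
    ∃ C : ℝ, 0 ≤ C ∧ ∀ u, ∀ s : Finset X, (∀ v ∈ s, T v = u) →
      ∑ v ∈ s, weight μ T v ^ 2 ≤ C := by
  have hσ : SigmaFinite μ := Measure.sigmaFinite_of_countable
    (S := Set.range fun x : X => ({x} : Set X)) (Set.countable_range _)
    (by rintro _ ⟨x, rfl⟩; exact (hμ x).2) (by ext x; simp)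
  have hac : μ.map T ≪ μ := by
    intro A hA
    have hA' : A = ∅ := by
      by_contra h
      obtain ⟨x, hx⟩ := Set.nonempty_iff_ne_empty.2 h
      exact (hμ x).1.ne' (measure_mono_null (Set.singleton_subset_iff.2 hx) hA)
    simp [hA']
  refine ⟨(essSup (hDeriv μ T) μ).toReal, ENNReal.toReal_nonneg, fun u s hs => ?_⟩
  have hpos : 0 < μ.real {u} := ENNReal.toReal_pos (hμ u).1.ne' (hμ u).2.ne
  have h1 : μ (T ⁻¹' {u}) ≤ essSup (hDeriv μ T) μ * μ {u} := by
    rw [← Measure.map_apply (measurable_of_countable T) (measurableSet_singleton u),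
      ← Measure.withDensity_rnDeriv_eq (μ.map T) μ hac,
      withDensity_apply _ (measurableSet_singleton u), ← setLIntegral_const]
    exact lintegral_mono_ae (ae_restrict_of_ae (ENNReal.ae_le_essSup _))
  have h2 : μ (s : Set X) ≤ essSup (hDeriv μ T) μ * μ {u} :=
    (measure_mono fun v hv => hs v hv).trans h1
  have h3 : μ.real (s : Set X) ≤ (essSup (hDeriv μ T) μ).toReal * μ.real {u} := by
    have := ENNReal.toReal_mono (ENNReal.mul_ne_top hT.ne (hμ u).2.ne) h2
    rwa [ENNReal.toReal_mul] at this
  have h4 : ∑ v ∈ s, weight μ T v ^ 2 = μ.real (s : Set X) / μ.real {u} := by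
    have h5 : ∑ v ∈ s, μ.real {v} = μ.real (s : Set X) := by
      simp only [Measure.real]
      rw [← ENNReal.toReal_sum fun v _ => (hμ v).2.ne, sum_measure_singleton]
    rw [← h5, Finset.sum_div]
    refine Finset.sum_congr rfl fun v hv => ?_
    rw [weight, hs v hv, div_pow, Real.sq_sqrt measureReal_nonneg, Real.sq_sqrt measureReal_nonneg]
  rw [h4, div_le_iff₀ hpos]
  exact h3

/-- The weighted shift `S_λ` on `ℓ²(X)`, as the bounded operator `(S_λ f)(v) = λ_v f(Tv)`; its values
on the basis vectors are computed in `hasSum_weightedShift_basisVec`. -/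
def weightedShift (hμ : IsDiscreteMeasure μ) (hT : HasBoundedDeriv μ T) :
    ℓ²(X, ℂ) →L[ℂ] ℓ²(X, ℂ) :=
  LinearMap.mkContinuous
    { toFun := fun f => ⟨fun v => (weight μ T v : ℂ) * f (T v),
        memℓp_gen' (sum_weighted_le (exists_bound hμ hT).choose_spec.1
          (exists_bound hμ hT).choose_spec.2 f)⟩
      map_add' := fun f g => by
        ext v
        exact mul_add _ _ _
      map_smul' := fun c f => by
        ext v
        exact mul_left_comm _ _ _ }
    (√(exists_bound hμ hT).choose)
    fun f => lp.norm_le_of_forall_sum_le (by norm_num) (by positivity)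
      (sum_weighted_le (exists_bound hμ hT).choose_spec.1 (exists_bound hμ hT).choose_spec.2 f)

theorem weightedShift_apply (hμ : IsDiscreteMeasure μ) (hT : HasBoundedDeriv μ T)
    (f : ℓ²(X, ℂ)) (v : X) :
    weightedShift hμ hT f v = (weight μ T v : ℂ) * f (T v) := rfl

end Shift

open Classical in
/-- The vectors `e_v` of the standard orthonormal basis of `ℓ²(X)`. -/
def basisVec (v : X) : ℓ²(X, ℂ) := lp.single 2 v 1

/-- `S_λ e_u = ∑_{Tv = u} λ_v e_v`. -/
theorem hasSum_weightedShift_basisVec [Countable X] [MeasurableSpace X] [DiscreteMeasurableSpace X]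
    {μ : Measure X} {T : X → X} (hμ : IsDiscreteMeasure μ) (hT : HasBoundedDeriv μ T) (u : X) :
    HasSum (fun v : {v : X // T v = u} => (weight μ T v : ℂ) • basisVec (v : X))
      (weightedShift hμ hT (basisVec u)) := by
  classical
  have h := lp.hasSum_single (p := 2) (by norm_num) (weightedShift hμ hT (basisVec u))
  have e : ∀ v : X, T v ≠ u → weightedShift hμ hT (basisVec u) v = 0 := fun v hv => by
    rw [weightedShift_apply, basisVec, lp.single_apply_ne _ _ _ hv, mul_zero]
  rw [← hasSum_subtype_iff_of_support_subset (s := {v : X | T v = u})] at h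
  · refine h.congr_fun ?_
    rintro ⟨v, hv⟩
    have hv : T v = u := hv
    have h1 : (basisVec u : ℓ²(X, ℂ)) u = 1 := by
      rw [basisVec, lp.single_apply_self]
    rw [Function.comp_apply, weightedShift_apply, hv, h1, basisVec, ← lp.single_smul, smul_eq_mul]
  · intro v hv
    by_contra hne
    refine hv ?_
    change lp.single (E := fun _ : X => ℂ) 2 v (weightedShift hμ hT (basisVec u) v) = 0
    rw [e v hne]
    exact lp.single_zero _ _

/-- `S` is `m`-isometric: `∑_{k=0}^m (-1)^{m-k} (m choose k) S^{*k} S^k = 0`. -/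
def IsMIsometric {H : Type*} [NormedAddCommGroup H] [InnerProductSpace ℂ H] [CompleteSpace H]
    (m : ℕ) (S : H →L[ℂ] H) : Prop :=
  ∑ k ∈ Finset.range (m + 1),
    ((-1 : ℂ) ^ (m - k) * (m.choose k : ℂ)) • (ContinuousLinearMap.adjoint S ^ k * S ^ k) = 0

/-- `p(n) = ‖S^n e_v‖²` for all natural numbers `n`. -/
def IsNormSqPoly (S : ℓ²(X, ℂ) →L[ℂ] ℓ²(X, ℂ)) (v : X) (p : ℝ[X]) : Prop :=
  ∀ n : ℕ, p.eval (n : ℝ) = ‖(S ^ n) (basisVec v)‖ ^ 2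

/-! ### The polynomial `q` -/

namespace OneCycleGraph

variable {T : X → X} {κ : ℕ}

/-- The vertex `v_{j mod κ}` of the cycle. -/
def vMod (G : OneCycleGraph T κ) (j : ℕ) : X := G.v ⟨j % κ, Nat.mod_lt j G.κ_pos⟩

/-- The vertices off the cycle. -/
abbrev OffCycle (G : OneCycleGraph T κ) : Type _ := {x : X // x ∉ Set.range G.v}

/-- The root `ω_R`, as a vertex off the cycle. -/
def rootOff (G : OneCycleGraph T κ) (R : G.trees) : G.OffCycle :=
  ⟨G.root R, by
    have h : (G.root R : X) ∈ ⋃₀ G.trees := ⟨R, R.2, (G.root R).2⟩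
    rwa [G.trees_cover] at h⟩

/-- The products `Λ_{k,i} = ∏_{j=k+1}^{k+i} λ_{v_{j mod κ}}`. -/
def bigLambda [MeasurableSpace X] (G : OneCycleGraph T κ) (μ : Measure X) (k i : ℕ) : ℝ :=
  ∏ j ∈ Finset.Icc (k + 1) (k + i), weight μ T (G.vMod j)

/-- The family `p` consists of the polynomials of degree at most `d` with `p_v(n) = ‖S^n e_v‖²`,
for all vertices `v` off the cycle. -/
def IsOffCycleFamily (G : OneCycleGraph T κ) (S : ℓ²(X, ℂ) →L[ℂ] ℓ²(X, ℂ)) (d : ℕ)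
    (p : G.OffCycle → ℝ[X]) : Prop :=
  ∀ v, (p v).natDegree ≤ d ∧ IsNormSqPoly S v (p v)

/-- `q` is a polynomial of degree at most `d` such that, for all real `x`,
`q(x) = ∑_{i=0}^{κ-1} Λ_{0,i}² ∑_{i_R = i} λ_{ω_R}² p_{ω_R}(x+κ-i-1)`,
where the inner sums are convergent. -/
def IsCyclePoly [MeasurableSpace X] (G : OneCycleGraph T κ) (μ : Measure X) (d : ℕ)
    (p : G.OffCycle → ℝ[X]) (q : ℝ[X]) : Prop :=
  q.natDegree ≤ d ∧ ∀ x : ℝ,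
    (∀ i : Fin κ, Summable fun R : {R : G.trees // G.idx R = i} =>
      weight μ T (G.root R) ^ 2 * (p (G.rootOff R)).eval (x + κ - i - 1)) ∧
    q.eval x = ∑ i : Fin κ, G.bigLambda μ 0 i ^ 2 *
      ∑' R : {R : G.trees // G.idx R = i},
        weight μ T (G.root R) ^ 2 * (p (G.rootOff R)).eval (x + κ - i - 1)

end OneCycleGraph

/-! ### The matrices -/

/-- `d_{i,j} = (m-i choose m-j-i) κ^j`, for `i + j ≤ m`. -/
def dCoeff (m κ i j : ℕ) : ℝ := ((m - i).choose (m - j - i) : ℝ) * (κ : ℝ) ^ j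

/-- The `m × m` matrix `A_{m,κ}`. With rows and columns numbered from `1`, row `r < m` has the entry
`d_{s,r+1-s}` in column `s ≤ r` and zeros elsewhere; row `m` is `(0, …, 0, 1)`. -/
def matA (m κ : ℕ) : Matrix (Fin m) (Fin m) ℝ :=
  Matrix.of fun r s =>
    if (r : ℕ) + 1 = m then (if (s : ℕ) + 1 = m then 1 else 0)
    else if (s : ℕ) ≤ r then dCoeff m κ (s + 1) (r + 1 - s) else 0

/-- The `(κ-1) × m` matrix `B_{m,κ}` with rows `(r^{m-1}, r^{m-2}, …, r^0)`, `r = 1, …, κ-1`. -/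
def matB (m κ : ℕ) : Matrix (Fin (κ - 1)) (Fin m) ℝ :=
  Matrix.of fun r s => ((r : ℝ) + 1) ^ (m - 1 - (s : ℕ))

/-- The column `b = (b_{m-2}, b_{m-3}, …, b_0, 1)` made of the coefficients of `q`. -/
def vecB (m : ℕ) (q : ℝ[X]) : Fin m → ℝ :=
  fun r => if (r : ℕ) + 1 = m then 1 else q.coeff (m - 2 - r)

/-- The column `a = (a_1, …, a_{κ-1})`, where `a_i = ‖S^i e_u‖²`. -/
def vecA (κ : ℕ) (S : ℓ²(X, ℂ) →L[ℂ] ℓ²(X, ℂ)) (u : X) : Fin (κ - 1) → ℝ :=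
  fun r => ‖(S ^ ((r : ℕ) + 1)) (basisVec u)‖ ^ 2

/-- The block matrix `[A b]`. -/
def matATilde (m κ : ℕ) (b : Fin m → ℝ) : Matrix (Fin m) (Fin m ⊕ Unit) ℝ :=
  Matrix.fromCols (matA m κ) (Matrix.replicateCol Unit b)

/-- The block matrix `[A b; B a]`. -/
def matBTilde (m κ : ℕ) (b : Fin m → ℝ) (a : Fin (κ - 1) → ℝ) :
    Matrix (Fin m ⊕ Fin (κ - 1)) (Fin m ⊕ Unit) ℝ :=
  Matrix.fromBlocks (matA m κ) (Matrix.replicateCol Unit b)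
    (matB m κ) (Matrix.replicateCol Unit a)

/-- The polynomial `c_{m-1} x^{m-1} + ⋯ + c_0` with `c = (c_{m-1}, …, c_0)`. -/
def polyOfCoeffs (m : ℕ) (c : Fin m → ℝ) : ℝ[X] :=
  ∑ s : Fin m, Polynomial.C (c s) * Polynomial.X ^ (m - 1 - (s : ℕ))

/-- The rank condition `m = rank [A b] = rank [A b; B a]` for the column `b` made of `q` and the
column `a` made of the numbers `‖S^i e_{v_0}‖²`. -/
def RankCondition {T : X → X} {κ : ℕ} (G : OneCycleGraph T κ) (S : ℓ²(X, ℂ) →L[ℂ] ℓ²(X, ℂ))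
    (m : ℕ) (q : ℝ[X]) : Prop :=
  (matATilde m κ (vecB m q)).rank = m ∧
    (matBTilde m κ (vecB m q) (vecA κ S (G.vMod 0))).rank = m

end CompOp

end

/-! The operators `S^{*n} S^n` are diagonal, with entry `μ(T⁻ⁿ{u}) / μ{u}` at `u`, so everything is
a statement about the sequences `n ↦ μ(T⁻ⁿ{u})`. Being `m`-isometric says that the `m`-th difference
of each of them vanishes at `0`. Summing over the fibre `T⁻ⁿ{u}` gives the same at every `n`, and
Newton's formula makes the sequences polynomials of degree at most `m - 1`.

Off the cycle one degree is lost (`exists_isNormSqPoly_offCycle`): if `T^{kκ} v = v_j`, then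
`T⁻ⁿ{v}` and `T⁻ⁿ{v_j}` are disjoint in `T^{-(n+kκ)}{v_j}`, so the polynomial of `v` is dominated by
a difference of that of `v_j`.

On the cycle, one full turn back from `v₀` collects the masses of all attached trees, so `‖S^{n+κ}
e_{v₀}‖² - ‖Sⁿ e_{v₀}‖² = q(n)` (`IsCyclePoly.eval_nat`). In terms of coefficients, `A c = b` says
`p(x+κ) - p(x) = q(x)` and `p(0) = 1`, while `B c = a` prescribes `p(1), …, p(κ-1)`. Since `A` is
invertible (`isUnit_matA`), the first rank is always `m`, and the second is `m` exactly when the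
unique solution of `A c = b` also satisfies `B c = a` (`rank_fromBlocks_replicateCol_iff`), i.e.
when `p` has the right initial values and hence represents `v₀`. Polynomiality at `v₀` and off the
cycle then spreads to the whole cycle (`fwdDiff_iter_fiberMass_vMod_eq_zero`). -/

namespace CompOp

/-! ### Masses of the iterated fibres -/

section FiberMass

variable {X : Type*} [MeasurableSpace X] {μ : Measure X} {T : X → X}

/-- The mass of the set `T⁻ⁿ{u}`. -/
def fiberMass (μ : Measure X) (T : X → X) (n : ℕ) (u : X) : ℝ :=
  μ.real (T^[n] ⁻¹' {u})

theorem IsDiscreteMeasure.real_pos (hμ : IsDiscreteMeasure μ) (u : X) : 0 < μ.real {u} :=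
  ENNReal.toReal_pos (hμ u).1.ne' (hμ u).2.ne

theorem fiberMass_nonneg (n : ℕ) (u : X) : 0 ≤ fiberMass μ T n u := measureReal_nonneg

@[simp]
theorem fiberMass_zero (u : X) : fiberMass μ T 0 u = μ.real {u} := rfl

theorem weight_sq (v : X) : weight μ T v ^ 2 = μ.real {v} / μ.real {T v} := by
  rw [weight, div_pow, Real.sq_sqrt measureReal_nonneg, Real.sq_sqrt measureReal_nonneg]

end FiberMass

section Basis

theorem basisVec_self {X : Type*} (u : X) : (basisVec u : ℓ²(X, ℂ)) u = 1 := by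
  classical rw [basisVec, lp.single_apply_self]

theorem basisVec_ne {X : Type*} {u v : X} (h : v ≠ u) : (basisVec u : ℓ²(X, ℂ)) v = 0 := by
  classical rw [basisVec, lp.single_apply_ne _ _ _ h]

theorem inner_basisVec {X : Type*} (u : X) (f : ℓ²(X, ℂ)) : inner ℂ (basisVec u) f = f u := by
  classical rw [basisVec, lp.inner_single_left]
  simp

end Basis

/-! ### Powers of the shift and the diagonal operators `S^{*n} S^n` -/

section Powers

variable {X : Type*} [Countable X] [MeasurableSpace X] [DiscreteMeasurableSpace X]
  {μ : Measure X} {T : X → X}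

theorem weightedShift_pow_apply (hμ : IsDiscreteMeasure μ) (hT : HasBoundedDeriv μ T)
    (n : ℕ) (f : ℓ²(X, ℂ)) (v : X) :
    (weightedShift hμ hT ^ n) f v =
      ((√(μ.real {v}) / √(μ.real {T^[n] v}) : ℝ) : ℂ) * f (T^[n] v) := by
  have hpos : ∀ u, √(μ.real {u}) ≠ 0 := fun u => (Real.sqrt_pos.2 (hμ.real_pos u)).ne'
  induction n generalizing v with
  | zero => simp [div_self (hpos v)]
  | succ n ih =>
    rw [pow_succ', mul_apply_eq_comp, weightedShift_apply, ih, ← mul_assoc,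
      ← Complex.ofReal_mul, weight, div_mul_div_cancel₀ (hpos _)]
    rfl

theorem hasSum_indicator_inner (hμ : IsDiscreteMeasure μ) (hT : HasBoundedDeriv μ T)
    (n : ℕ) (u : X) (f : ℓ²(X, ℂ)) :
    HasSum (fun v => (((T^[n] ⁻¹' {u}).indicator (fun v => μ.real {v} / μ.real {u}) v : ℝ) : ℂ)
        * f u)
      (inner ℂ ((weightedShift hμ hT ^ n) (basisVec u)) ((weightedShift hμ hT ^ n) f)) := by
  refine (lp.hasSum_inner _ _).congr_fun fun v => ?_
  rw [weightedShift_pow_apply, weightedShift_pow_apply]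
  by_cases h : T^[n] v = u
  · have h' : v ∈ T^[n] ⁻¹' {u} := h
    rw [Set.indicator_of_mem h', h, basisVec_self, mul_one, RCLike.inner_apply]
    change _ = ((_ : ℝ) : ℂ) * _ * (starRingEnd ℂ) ((_ : ℝ) : ℂ)
    rw [Complex.conj_ofReal, mul_right_comm, ← Complex.ofReal_mul, div_mul_div_comm,
      Real.mul_self_sqrt measureReal_nonneg, Real.mul_self_sqrt measureReal_nonneg]
  · have h' : v ∉ T^[n] ⁻¹' {u} := h
    rw [Set.indicator_of_notMem h', basisVec_ne h]
    simp

theorem hasSum_indicator_norm_sq (hμ : IsDiscreteMeasure μ) (hT : HasBoundedDeriv μ T)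
    (n : ℕ) (u : X) :
    HasSum ((T^[n] ⁻¹' {u}).indicator (fun v => μ.real {v} / μ.real {u}))
      (‖(weightedShift hμ hT ^ n) (basisVec u)‖ ^ 2) := by
  have h := hasSum_indicator_inner hμ hT n u (basisVec u)
  rw [basisVec_self, inner_self_eq_norm_sq_to_K] at h
  simp only [mul_one] at h
  rw [← Complex.hasSum_ofReal]
  simpa using h

/-- The extended-real form makes finiteness of the fibre part of the conclusion; the real-valued
measure would silently be `0` on an infinite fibre. -/
theorem measure_fiber (hμ : IsDiscreteMeasure μ) (hT : HasBoundedDeriv μ T) (n : ℕ) (u : X) :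
    μ (T^[n] ⁻¹' {u}) =
      ENNReal.ofReal (μ.real {u} * ‖(weightedShift hμ hT ^ n) (basisVec u)‖ ^ 2) := by
  have hs : HasSum ((T^[n] ⁻¹' {u}).indicator fun v => μ.real {v})
      (μ.real {u} * ‖(weightedShift hμ hT ^ n) (basisVec u)‖ ^ 2) := by
    refine ((hasSum_indicator_norm_sq hμ hT n u).mul_left (μ.real {u})).congr_fun fun v => ?_
    by_cases h : v ∈ T^[n] ⁻¹' {u}
    · simp only [Set.indicator_of_mem h, mul_div_cancel₀ _ (hμ.real_pos u).ne']
    · simp only [Set.indicator_of_notMem h, mul_zero]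
  rw [← Measure.tsum_indicator_apply_singleton μ _ (MeasurableSet.of_discrete), ← hs.tsum_eq,
    ENNReal.ofReal_tsum_of_nonneg (fun v => Set.indicator_nonneg (fun _ _ => measureReal_nonneg) _)
      hs.summable]
  refine tsum_congr fun v => ?_
  by_cases h : v ∈ T^[n] ⁻¹' {u}
  · simp only [Set.indicator_of_mem h, ofReal_measureReal (hμ v).2.ne]
  · simp only [Set.indicator_of_notMem h, ENNReal.ofReal_zero]

theorem measure_fiber_ne_top (hμ : IsDiscreteMeasure μ) (hT : HasBoundedDeriv μ T)
    (n : ℕ) (u : X) : μ (T^[n] ⁻¹' {u}) ≠ ∞ := by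
  rw [measure_fiber hμ hT]
  exact ENNReal.ofReal_ne_top

theorem norm_sq_pow_basisVec (hμ : IsDiscreteMeasure μ) (hT : HasBoundedDeriv μ T)
    (n : ℕ) (u : X) :
    ‖(weightedShift hμ hT ^ n) (basisVec u)‖ ^ 2 = fiberMass μ T n u / μ.real {u} := by
  rw [fiberMass, measureReal_def, measure_fiber hμ hT,
    ENNReal.toReal_ofReal (mul_nonneg measureReal_nonneg (sq_nonneg _)),
    mul_div_cancel_left₀ _ (hμ.real_pos u).ne']

theorem inner_pow_basisVec (hμ : IsDiscreteMeasure μ) (hT : HasBoundedDeriv μ T)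
    (n : ℕ) (u : X) (f : ℓ²(X, ℂ)) :
    inner ℂ ((weightedShift hμ hT ^ n) (basisVec u)) ((weightedShift hμ hT ^ n) f) =
      ((fiberMass μ T n u / μ.real {u} : ℝ) : ℂ) * f u := by
  refine (hasSum_indicator_inner hμ hT n u f).unique ?_
  rw [← norm_sq_pow_basisVec hμ hT]
  exact ((Complex.hasSum_ofReal.2 (hasSum_indicator_norm_sq hμ hT n u)).mul_right (f u))

theorem adjoint_pow_mul_pow_apply (hμ : IsDiscreteMeasure μ) (hT : HasBoundedDeriv μ T)
    (n : ℕ) (u : X) (f : ℓ²(X, ℂ)) :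
    (ContinuousLinearMap.adjoint (weightedShift hμ hT) ^ n * weightedShift hμ hT ^ n) f u =
      ((fiberMass μ T n u / μ.real {u} : ℝ) : ℂ) * f u := by
  rw [← inner_basisVec, ← ContinuousLinearMap.star_eq_adjoint, ← star_pow,
    ContinuousLinearMap.star_eq_adjoint, mul_apply_eq_comp,
    ContinuousLinearMap.adjoint_inner_right, inner_pow_basisVec]

theorem isMIsometric_weightedShift_iff (hμ : IsDiscreteMeasure μ) (hT : HasBoundedDeriv μ T)
    (m : ℕ) :
    IsMIsometric m (weightedShift hμ hT) ↔ ∀ u, ∑ k ∈ Finset.range (m + 1),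
      ((-1 : ℝ) ^ (m - k) * (m.choose k : ℝ)) * fiberMass μ T k u = 0 := by
  have key : ∀ (f : ℓ²(X, ℂ)) (u : X), (∑ k ∈ Finset.range (m + 1),
      ((-1 : ℂ) ^ (m - k) * (m.choose k : ℂ)) • (ContinuousLinearMap.adjoint
        (weightedShift hμ hT) ^ k * weightedShift hμ hT ^ k)) f u =
      (((∑ k ∈ Finset.range (m + 1), ((-1 : ℝ) ^ (m - k) * (m.choose k : ℝ)) *
        fiberMass μ T k u) / μ.real {u} : ℝ) : ℂ) * f u := by
    intro f u
    have hev : ∀ g : ℕ → (ℓ²(X, ℂ) →L[ℂ] ℓ²(X, ℂ)),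
        (∑ k ∈ Finset.range (m + 1), g k) f u = ∑ k ∈ Finset.range (m + 1), g k f u := by
      intro g
      simp only [← inner_basisVec, sum_apply, inner_sum]
    rw [hev, Finset.sum_div, Complex.ofReal_sum, Finset.sum_mul]
    refine Finset.sum_congr rfl fun k _ => ?_
    refine (congrArg (((-1 : ℂ) ^ (m - k) * (m.choose k : ℂ)) * ·)
      (adjoint_pow_mul_pow_apply hμ hT k u f)).trans ?_
    push_cast
    ring
  unfold IsMIsometric
  constructor
  · intro h u
    have h1 := key (basisVec u) u
    rw [h, basisVec_self, mul_one] at h1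
    have h2 : ((0 : ℓ²(X, ℂ) →L[ℂ] ℓ²(X, ℂ)) (basisVec u)) u = 0 := rfl
    rw [h2] at h1
    have h3 := Complex.ofReal_eq_zero.1 h1.symm
    exact (div_eq_zero_iff.1 h3).resolve_right (hμ.real_pos u).ne'
  · intro h
    ext f u
    rw [key, h]
    simp

/-- Countable additivity: `T^{-(n+k)}{u}` is the disjoint union of the sets `T⁻ⁿ{w}` over `w ∈
T⁻ᵏ{u}`. -/
theorem hasSum_fiberMass (hμ : IsDiscreteMeasure μ) (hT : HasBoundedDeriv μ T)
    (n k : ℕ) (u : X) :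
    HasSum (fun w : {w // T^[k] w = u} => fiberMass μ T n w) (fiberMass μ T (n + k) u) := by
  have h1 : T^[n + k] ⁻¹' {u} = ⋃ w : {w // T^[k] w = u}, T^[n] ⁻¹' {(w : X)} := by
    ext x
    simp [add_comm n k, Function.iterate_add_apply]
  have h2 : μ (T^[n + k] ⁻¹' {u}) = ∑' w : {w // T^[k] w = u}, μ (T^[n] ⁻¹' {(w : X)}) := by
    rw [h1]
    refine measure_iUnion (fun w w' hw => ?_) fun _ => MeasurableSet.of_discrete
    exact Disjoint.preimage _ (Set.disjoint_singleton.2 fun h => hw (Subtype.ext h))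
  have h3 := ENNReal.hasSum_toReal (h2 ▸ measure_fiber_ne_top hμ hT (n + k) u)
  rw [← ENNReal.tsum_toReal_eq fun w : {w // T^[k] w = u} =>
    measure_fiber_ne_top hμ hT n w, ← h2] at h3
  exact h3

end Powers

/-! ### The cycle and the trees attached to it -/

namespace OneCycleGraph

variable {X : Type*} {T : X → X} {κ : ℕ} (G : OneCycleGraph T κ)

theorem vMod_mem_range (j : ℕ) : G.vMod j ∈ Set.range G.v := ⟨_, rfl⟩

theorem vMod_add_mul (j k : ℕ) : G.vMod (j + k * κ) = G.vMod j := by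
  simp [vMod]

theorem vMod_coe (i : Fin κ) : G.vMod i = G.v i := by
  simp [vMod, Nat.mod_eq_of_lt i.2]

theorem map_vMod_succ (j : ℕ) : T (G.vMod (j + 1)) = G.vMod j := by
  have hlt := Nat.mod_lt j G.κ_pos
  rcases (show j % κ + 1 ≤ κ from hlt).lt_or_eq with h | h
  · have h1 : (j + 1) % κ = j % κ + 1 := by
      rw [Nat.add_mod, Nat.mod_eq_of_lt (a := 1) (by omega), Nat.mod_eq_of_lt h]
    have h2 := G.adj_succ (j % κ) h
    have h3 : G.vMod (j + 1) = G.v ⟨j % κ + 1, h⟩ := congrArg G.v (Fin.ext h1)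
    rw [h3]
    exact h2
  · have h1 : (j + 1) % κ = 0 := by
      rw [← Nat.mod_add_mod, h, Nat.mod_self]
    have h3 : G.vMod (j + 1) = G.v ⟨0, G.κ_pos⟩ := congrArg G.v (Fin.ext h1)
    have h4 : G.vMod j = G.v ⟨κ - 1, Nat.sub_lt G.κ_pos Nat.one_pos⟩ :=
      congrArg G.v (Fin.ext (by simp only; omega))
    rw [h3, h4]
    exact G.adj_last

theorem iterate_vMod_add (n j : ℕ) : T^[n] (G.vMod (j + n)) = G.vMod j := by
  induction n with
  | zero => rfl
  | succ n ih => rw [Function.iterate_succ_apply, ← add_assoc, G.map_vMod_succ, ih]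

theorem exists_iterate_vMod (n j : ℕ) : ∃ i, T^[n] (G.vMod j) = G.vMod i := by
  -- Adding `n` full turns keeps the index `j - n` from being truncated.
  refine ⟨j + n * κ - n, ?_⟩
  have : n ≤ n * κ := Nat.le_mul_of_pos_right n G.κ_pos
  rw [← G.iterate_vMod_add n (j + n * κ - n),
    show j + n * κ - n + n = j + n * κ by omega, vMod_add_mul]

/-- Every vertex reaches the cycle. -/
theorem exists_iterate_eq_vMod (hconn : Connected (selfMapGraph T)) (x : X) :
    ∃ n j, T^[n] x = G.vMod j := by
  by_cases hx : G.vMod 0 = x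
  · exact ⟨0, 0, hx.symm⟩
  -- Reaching the cycle passes along an edge in either direction, hence along any undirected path
  -- from `v₀`.
  have step : ∀ a b, (∃ n j, T^[n] a = G.vMod j) → (T b = a ∨ T a = b) →
      ∃ n j, T^[n] b = G.vMod j := by
    rintro a b ⟨n, j, h⟩ (rfl | rfl)
    · exact ⟨n + 1, j, h⟩
    · obtain ⟨i, hi⟩ := G.exists_iterate_vMod 1 j
      refine ⟨n, i, ?_⟩
      rw [← hi, ← h]
      exact (Function.Commute.iterate_self T n).eq a
  induction hconn _ _ hx with
  | single h => exact step _ _ ⟨0, 0, rfl⟩ h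
  | @tail b c _ h ih =>
    by_cases hb : G.vMod 0 = b
    · exact step _ _ ⟨0, 0, hb.symm⟩ h
    · exact step _ _ (ih hb) h

/-- Once on the cycle, further steps stay on it. A number of steps divisible by `κ` is wanted
because such an iterate fixes the vertex reached. -/
theorem exists_iterate_mul_eq_vMod (hconn : Connected (selfMapGraph T)) (x : X) :
    ∃ k j, T^[k * κ] x = G.vMod j := by
  obtain ⟨n, j, h⟩ := G.exists_iterate_eq_vMod hconn x
  obtain ⟨i, hi⟩ := G.exists_iterate_vMod (n * κ - n) j
  refine ⟨n, i, ?_⟩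
  have : n ≤ n * κ := Nat.le_mul_of_pos_right n G.κ_pos
  rw [← hi, ← h, ← Function.iterate_add_apply, Nat.sub_add_cancel this]

theorem root_injective : Function.Injective fun R : G.trees => (G.root R : X) := by
  intro R R' h
  by_contra hne
  have := G.trees_disjoint R.2 R'.2 fun e => hne (Subtype.ext e)
  refine Set.disjoint_left.1 this (G.root R).2 ?_
  have h : (G.root R : X) = G.root R' := h
  rw [h]
  exact (G.root R').2

theorem map_root (R : G.trees) : T (G.root R) = G.v (G.idx R) :=
  (G.adj_root_iff R _).2 rfl

/-- A vertex of a rooted directed tree whose parent lies outside the tree is the root. -/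
theorem eq_root_of_map_notMem (R : G.trees) {x : X} (hx : x ∈ (R : Set X))
    (hTx : T x ∉ (R : Set X)) : (G.root R : X) = x := by
  have ht := G.isRootedTree R
  set r : (R : Set X) := ⟨x, hx⟩ with hr
  have hrTx : ∀ b : (R : Set X), ¬ (inducedGraph (selfMapGraph T) (R : Set X)).Adj b r :=
    fun b hb => hTx (by
      have hb : T x = b := hb
      rw [hb]
      exact b.2)
  by_contra hne
  have hne : r ≠ G.root R := fun e => hne (by rw [← e])
  -- An undirected path from `r` can be straightened into a directed one: a step up to a parent
  -- undoes the last step down, by in-degree at most one, and `r` itself has no parent in the tree.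
  -- So the root is a descendant of `r`, which forces it to be `r`.
  have key : ∀ b, Relation.TransGen (fun a b =>
      (inducedGraph (selfMapGraph T) (R : Set X)).Adj a b ∨
      (inducedGraph (selfMapGraph T) (R : Set X)).Adj b a) r b →
      Relation.ReflTransGen (inducedGraph (selfMapGraph T) (R : Set X)).Adj r b := by
    have step : ∀ a b, Relation.ReflTransGen (inducedGraph (selfMapGraph T) (R : Set X)).Adj r a →
        ((inducedGraph (selfMapGraph T) (R : Set X)).Adj a b ∨
          (inducedGraph (selfMapGraph T) (R : Set X)).Adj b a) →
        Relation.ReflTransGen (inducedGraph (selfMapGraph T) (R : Set X)).Adj r b := by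
      rintro a b ha (h | h)
      · exact ha.tail h
      · rcases Relation.ReflTransGen.cases_tail ha with e | ⟨c, hc, hca⟩
        · subst e
          exact absurd h (hrTx b)
        · rwa [ht.indegree_le_one a b c h hca]
    intro b hb
    induction hb with
    | single h => exact step _ _ .refl h
    | tail _ h ih => exact step _ _ ih h
  rcases Relation.ReflTransGen.cases_tail (key _ (ht.connected _ _ hne)) with e | ⟨c, _, hc⟩
  · exact hne e.symm
  · exact ht.indegree_root c hc

theorem exists_root_eq {x : X} (hx : x ∉ Set.range G.v) (hTx : T x ∈ Set.range G.v) :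
    ∃ R, (G.root R : X) = x := by
  have h : x ∈ ⋃₀ G.trees := by rwa [G.trees_cover]
  obtain ⟨R, hR, hxR⟩ := h
  refine ⟨⟨R, hR⟩, G.eq_root_of_map_notMem ⟨R, hR⟩ hxR fun h => ?_⟩
  have h1 : T x ∈ ⋃₀ G.trees := ⟨R, hR, h⟩
  rw [G.trees_cover] at h1
  exact h1 hTx

/-- The index `j mod κ`. -/
def modIdx (j : ℕ) : Fin κ := ⟨j % κ, Nat.mod_lt j G.κ_pos⟩

theorem eq_vMod_succ {x : X} (hx : x ∈ Set.range G.v) {j : ℕ} (hTx : T x = G.vMod j) :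
    x = G.vMod (j + 1) := by
  obtain ⟨i, rfl⟩ := hx
  -- The index `i + κ - 1` stands for the predecessor of `i`; the `κ` avoids truncation at `i = 0`.
  have h0 : G.v i = G.vMod (i + κ - 1 + 1) := by
    rw [show (i : ℕ) + κ - 1 + 1 = i + 1 * κ by have := G.κ_pos; omega, G.vMod_add_mul, vMod_coe]
  rw [h0, G.map_vMod_succ] at hTx
  rw [h0]
  have h1 : (i + κ - 1) % κ = j % κ := congrArg Fin.val (G.v_injective hTx)
  exact congrArg G.v (Fin.ext (Nat.ModEq.add_right 1 h1))

/-- The children of a vertex of the cycle. -/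
theorem fiber_vMod (j : ℕ) : {x | T^[1] x = G.vMod j} = {G.vMod (j + 1)} ∪
    Set.range fun R : {R : G.trees // G.idx R = G.modIdx j} => (G.root R : X) := by
  ext x
  simp only [Set.mem_ofPred_eq, Function.iterate_one, Set.singleton_union, Set.mem_insert_iff,
    Set.mem_range]
  constructor
  · intro h
    by_cases hx : x ∈ Set.range G.v
    · exact Or.inl (G.eq_vMod_succ hx h)
    · obtain ⟨R, rfl⟩ := G.exists_root_eq hx (h ▸ G.vMod_mem_range j)
      exact Or.inr ⟨⟨R, ((G.adj_root_iff R _).1 h).symm⟩, rfl⟩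
  · rintro (rfl | ⟨R, rfl⟩)
    · exact G.map_vMod_succ j
    · rw [G.map_root, R.2]
      rfl

theorem root_ne_vMod (R : G.trees) (j : ℕ) : (G.root R : X) ≠ G.vMod j := fun h =>
  (G.rootOff R).2 (by
    change (G.root R : X) ∈ Set.range G.v
    rw [h]
    exact G.vMod_mem_range j)

theorem bigLambda_zero_sq [MeasurableSpace X] {μ : Measure X} (hμ : IsDiscreteMeasure μ) (i : ℕ) :
    G.bigLambda μ 0 i ^ 2 = μ.real {G.vMod i} / μ.real {G.vMod 0} := by
  rw [bigLambda, zero_add, zero_add]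
  induction i with
  | zero => simp [div_self (hμ.real_pos _).ne']
  | succ i ih =>
    rw [Finset.prod_Icc_succ_top (by omega), mul_pow, ih, weight_sq, G.map_vMod_succ, mul_comm,
      div_mul_div_cancel₀ (hμ.real_pos _).ne']

/-! ### Recurrences for the masses along the cycle -/

section Mass

variable [Countable X] [MeasurableSpace X] [DiscreteMeasurableSpace X] {μ : Measure X}

/-- The mass of `T⁻ⁿ` of the set of roots attached to `v_{j mod κ}`. -/
noncomputable def rootMass (μ : Measure X) (j n : ℕ) : ℝ :=
  ∑' R : {R : G.trees // G.idx R = G.modIdx j}, fiberMass μ T n (G.root R)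

/-- The roots are distinct points of `T⁻¹{v_j}`, so this is a subfamily of a convergent series, and
the `tsum` defining `rootMass` is a genuine sum. -/
theorem hasSum_rootMass (hμ : IsDiscreteMeasure μ) (hT : HasBoundedDeriv μ T) (j n : ℕ) :
    HasSum (fun R : {R : G.trees // G.idx R = G.modIdx j} => fiberMass μ T n (G.root R))
      (G.rootMass μ j n) := by
  refine Summable.hasSum ?_
  have h := (hasSum_fiberMass hμ hT n 1 (G.vMod j)).summable
  refine h.comp_injective (i := fun R : {R : G.trees // G.idx R = G.modIdx j} =>
    (⟨G.root R, by rw [Function.iterate_one, G.map_root, R.2]; rfl⟩ :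
      {w // T^[1] w = G.vMod j})) fun R R' hR => ?_
  exact Subtype.ext (G.root_injective (congrArg Subtype.val hR))

theorem fiberMass_succ_vMod (hμ : IsDiscreteMeasure μ) (hT : HasBoundedDeriv μ T) (j n : ℕ) :
    fiberMass μ T (n + 1) (G.vMod j) = fiberMass μ T n (G.vMod (j + 1)) + G.rootMass μ j n := by
  have h1 : HasSum (fun w : {x | T^[1] x = G.vMod j} => fiberMass μ T n w)
    (fiberMass μ T (n + 1) (G.vMod j)) := hasSum_fiberMass hμ hT n 1 (G.vMod j)
  rw [fiber_vMod] at h1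
  refine h1.unique (HasSum.add_disjoint (f := fiberMass μ T n) ?_
    (hasSum_singleton (G.vMod (j + 1)) _) ?_)
  · rw [Set.disjoint_singleton_left]
    rintro ⟨R, hR⟩
    exact G.root_ne_vMod _ _ hR
  · refine (Function.Injective.hasSum_range_iff (f := fiberMass μ T n) ?_).2
      (G.hasSum_rootMass hμ hT j n)
    exact fun R R' h => Subtype.ext (G.root_injective h)

/-- Going back `i` steps along the cycle sheds the trees at `v_0, …, v_{i-1}`. A root attached to
`v_l` lies `l + 1` steps behind `v_0`, which leaves `n + i - l - 1` steps inside its tree. -/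
theorem fiberMass_add_vMod_zero (hμ : IsDiscreteMeasure μ) (hT : HasBoundedDeriv μ T)
    (i n : ℕ) : fiberMass μ T (n + i) (G.vMod 0) = fiberMass μ T n (G.vMod i) +
      ∑ l ∈ Finset.range i, G.rootMass μ l (n + i - l - 1) := by
  induction i generalizing n with
  | zero => simp
  | succ i ih =>
    rw [show n + (i + 1) = n + 1 + i by ring, ih (n + 1), fiberMass_succ_vMod G hμ hT,
      Finset.sum_range_succ, show n + 1 + i - i - 1 = n by omega]
    ring

theorem fiberMass_add_period (hμ : IsDiscreteMeasure μ) (hT : HasBoundedDeriv μ T) (n : ℕ) :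
    fiberMass μ T (n + κ) (G.vMod 0) = fiberMass μ T n (G.vMod 0) +
      ∑ l ∈ Finset.range κ, G.rootMass μ l (n + κ - l - 1) := by
  have := G.vMod_add_mul 0 1
  rw [one_mul, zero_add] at this
  rw [fiberMass_add_vMod_zero G hμ hT, this]

end Mass

end OneCycleGraph

/-! ### Finite differences, growth and interpolation of polynomials -/

section Differences

theorem fwdDiff_iter_eq_zero_of_le {f : ℕ → ℝ} {m k : ℕ} (h : ∀ n, (fwdDiff 1)^[m] f n = 0)
    (hk : m ≤ k) (n : ℕ) : (fwdDiff 1)^[k] f n = 0 := by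
  obtain ⟨l, rfl⟩ := Nat.exists_eq_add_of_le' hk
  rw [Function.iterate_add_apply, show (fwdDiff 1)^[m] f = fun _ => (0 : ℝ) from funext h,
    fwdDiff_iter_eq_sum_shift]
  simp

/-- Newton's formula: a sequence whose `m`-th differences vanish is a polynomial. -/
theorem exists_polynomial_of_fwdDiff_iter_eq_zero {f : ℕ → ℝ} {m : ℕ}
    (h : ∀ n, (fwdDiff 1)^[m] f n = 0) :
    ∃ p : ℝ[X], p.natDegree ≤ m - 1 ∧ ∀ n : ℕ, p.eval (n : ℝ) = f n := by
  refine ⟨∑ k ∈ Finset.range m,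
      Polynomial.C ((fwdDiff 1)^[k] f 0 / k.factorial) * descPochhammer ℝ k,
    Polynomial.natDegree_sum_le_of_forall_le _ _ fun k hk => ?_, fun n => ?_⟩
  · refine (Polynomial.natDegree_C_mul_le _ _).trans ?_
    rw [descPochhammer_natDegree]
    exact Nat.le_pred_of_lt (Finset.mem_range.1 hk)
  · have h1 := shift_eq_sum_fwdDiff_iter 1 f n 0
    simp only [nsmul_eq_mul, zero_add, mul_one, Nat.cast_id] at h1
    have h2 : ∀ k, Polynomial.eval (n : ℝ)
        (Polynomial.C ((fwdDiff 1)^[k] f 0 / k.factorial) * descPochhammer ℝ k) =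
          (n.choose k : ℝ) * (fwdDiff 1)^[k] f 0 := fun k => by
      rw [Polynomial.eval_C_mul, descPochhammer_eval_eq_descFactorial,
        Nat.descFactorial_eq_factorial_mul_choose, Nat.cast_mul]
      field_simp
    rw [h1, Polynomial.eval_finsetSum, Finset.sum_congr rfl fun k _ => h2 k]
    -- The two sums stop at different places but agree: the binomials vanish for `k > n`, the
    -- differences for `k ≥ m`.
    rcases le_total m (n + 1) with hmn | hmn
    · refine Finset.sum_subset (Finset.range_mono hmn) fun k _ hk => ?_
      rw [fwdDiff_iter_eq_zero_of_le h (by simpa using hk), mul_zero]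
    · refine (Finset.sum_subset (Finset.range_mono hmn) fun k _ hk => ?_).symm
      rw [Nat.choose_eq_zero_of_lt (by simpa using hk), Nat.cast_zero, zero_mul]

theorem fwdDiff_iter_eval_eq_zero {p : ℝ[X]} {m : ℕ} (hp : p.natDegree < m) (n : ℕ) :
    (fwdDiff 1)^[m] (fun k : ℕ => p.eval (k : ℝ)) n = 0 := by
  have h := congrFun (Polynomial.fwdDiff_iter_eq_zero_of_degree_lt hp) (n : ℝ)
  rw [fwdDiff_iter_eq_sum_shift] at h ⊢
  simpa using h

end Differences

theorem polynomial_eq_of_eval_nat {p q : ℝ[X]} (h : ∀ n : ℕ, p.eval (n : ℝ) = q.eval (n : ℝ)) :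
    p = q :=
  Polynomial.eq_of_infinite_eval_eq p q
    ((Set.infinite_range_of_injective Nat.cast_injective).mono (by rintro _ ⟨n, rfl⟩; exact h n))

/-- Otherwise `q / p` would tend to `0`, although it is at least `1` at all large integers. -/
theorem natDegree_le_of_eval_nat_le {p q : ℝ[X]} (h0 : ∀ n : ℕ, 0 ≤ p.eval (n : ℝ))
    (h : ∀ n : ℕ, p.eval (n : ℝ) ≤ q.eval (n : ℝ)) : p.natDegree ≤ q.natDegree := by
  by_contra! hlt
  have ht := (Polynomial.div_tendsto_atTop_zero_of_degree_lt q p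
    (Polynomial.degree_lt_degree hlt)).comp (tendsto_natCast_atTop_atTop (R := ℝ))
  have hne : p ≠ 0 := by rintro rfl; simp at hlt
  have hroot : ∀ᶠ n : ℕ in Filter.atTop, p.eval (n : ℝ) ≠ 0 :=
    (tendsto_natCast_atTop_atTop (R := ℝ)).eventually
      (Polynomial.eventually_atTop_not_isRoot p hne)
  have h1 : ∀ᶠ n : ℕ in Filter.atTop, (1 : ℝ) ≤ q.eval (n : ℝ) / p.eval (n : ℝ) := by
    filter_upwards [hroot] with n hn
    rw [one_le_div ((h0 n).lt_of_ne' hn)]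
    exact h n
  have := ge_of_tendsto ht h1
  norm_num at this

theorem natDegree_comp_X_add_C_sub_le {p : ℝ[X]} {m : ℕ} (hp : p.natDegree ≤ m) (t : ℝ) :
    (p.comp (Polynomial.X + Polynomial.C t) - p).natDegree ≤ m - 1 := by
  rw [← Polynomial.taylor_apply]
  rcases Nat.eq_zero_or_pos m with rfl | hm
  · rw [Polynomial.eq_C_of_natDegree_le_zero hp]
    simp
  refine Polynomial.natDegree_le_iff_coeff_eq_zero.2 fun N hN => ?_
  rw [Polynomial.coeff_sub]
  rcases (show m ≤ N by omega).lt_or_eq with hN | rfl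
  · rw [Polynomial.coeff_eq_zero_of_natDegree_lt, Polynomial.coeff_eq_zero_of_natDegree_lt,
      sub_zero]
    · omega
    · rw [Polynomial.natDegree_taylor]
      omega
  · rcases hp.lt_or_eq with h | rfl
    · rw [Polynomial.coeff_eq_zero_of_natDegree_lt, Polynomial.coeff_eq_zero_of_natDegree_lt,
        sub_zero]
      · exact h
      · rwa [Polynomial.natDegree_taylor]
    · rw [Polynomial.coeff_taylor_natDegree, Polynomial.leadingCoeff, sub_self]

/-- Lagrange interpolation at `0, …, d`. -/
theorem eval_eq_sum_eval_nat {p : ℝ[X]} {d : ℕ} (hp : p.natDegree ≤ d) (x : ℝ) :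
    p.eval x = ∑ j ∈ Finset.range (d + 1), (Lagrange.basis (Finset.range (d + 1))
      (fun n : ℕ => (n : ℝ)) j).eval x * p.eval (j : ℝ) := by
  have hlt : p.degree < (Finset.range (d + 1)).card := by
    rw [Finset.card_range]
    exact (Polynomial.degree_le_of_natDegree_le hp).trans_lt
      (by exact_mod_cast d.lt_succ_self)
  conv_lhs => rw [Lagrange.eq_interpolate (s := Finset.range (d + 1))
    (v := fun n : ℕ => (n : ℝ)) (Nat.cast_injective.injOn) hlt, Lagrange.interpolate_apply,
    Polynomial.eval_finsetSum]
  exact Finset.sum_congr rfl fun j _ => by rw [Polynomial.eval_C_mul, mul_comm]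

theorem natDegree_lagrange_basis_le {d j : ℕ} (hj : j ∈ Finset.range (d + 1)) :
    (Lagrange.basis (Finset.range (d + 1)) (fun n : ℕ => (n : ℝ)) j).natDegree ≤ d := by
  refine Polynomial.natDegree_le_of_degree_le ?_
  rw [Lagrange.degree_basis (Nat.cast_injective.injOn) hj, Finset.card_range]
  rfl

/-- A pointwise sum of polynomials of bounded degree that converges at `0, 1, …, d` is a
polynomial. -/
theorem hasSum_eval_of_hasSum_eval_nat {ι : Type*} {d : ℕ} {p : ι → ℝ[X]}
    (hp : ∀ i, (p i).natDegree ≤ d) {s : ℕ → ℝ}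
    (hs : ∀ j ≤ d, HasSum (fun i => (p i).eval (j : ℝ)) (s j)) :
    ∃ q : ℝ[X], q.natDegree ≤ d ∧ ∀ x, HasSum (fun i => (p i).eval x) (q.eval x) := by
  -- The value of each term at `x` is a fixed finite combination of its values at `0, …, d`, so
  -- convergence there carries over to every `x`; the limit is the interpolant of the `s j`.
  refine ⟨∑ j ∈ Finset.range (d + 1), Lagrange.basis (Finset.range (d + 1))
      (fun n : ℕ => (n : ℝ)) j * Polynomial.C (s j),
    Polynomial.natDegree_sum_le_of_forall_le _ _ fun j hj =>
      (Polynomial.natDegree_mul_C_le _ _).trans (natDegree_lagrange_basis_le hj), fun x => ?_⟩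
  rw [Polynomial.eval_finsetSum]
  have h := hasSum_sum fun j (hj : j ∈ Finset.range (d + 1)) =>
    (hs j (Nat.lt_succ_iff.1 (Finset.mem_range.1 hj))).mul_left ((Lagrange.basis
      (Finset.range (d + 1)) (fun n : ℕ => (n : ℝ)) j).eval x)
  simp only [Polynomial.eval_mul, Polynomial.eval_C]
  exact h.congr_fun fun i => eval_eq_sum_eval_nat (hp i) x

/-! ### The matrices as operations on polynomials -/

section Matrices

open Polynomial Matrix

variable {m κ : ℕ}

theorem coeff_polyOfCoeffs (c : Fin m → ℝ) (s : Fin m) :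
    (polyOfCoeffs m c).coeff (m - 1 - s) = c s := by
  rw [polyOfCoeffs, finsetSum_coeff, Finset.sum_eq_single s]
  · simp
  · intro t _ hts
    rw [coeff_C_mul, coeff_X_pow, if_neg, mul_zero]
    intro h
    exact hts (Fin.ext (by omega))
  · simp

theorem natDegree_polyOfCoeffs_le (c : Fin m → ℝ) : (polyOfCoeffs m c).natDegree ≤ m - 1 :=
  natDegree_sum_le_of_forall_le _ _ fun _ _ =>
    (natDegree_C_mul_X_pow_le _ _).trans (Nat.sub_le _ _)

theorem polyOfCoeffs_coeff (hm : 1 ≤ m) {p : ℝ[X]} (hp : p.natDegree ≤ m - 1) :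
    polyOfCoeffs m (fun s => p.coeff (m - 1 - s)) = p := by
  ext k
  by_cases hk : k ≤ m - 1
  · have h := coeff_polyOfCoeffs (m := m) (fun s => p.coeff (m - 1 - s)) ⟨m - 1 - k, by omega⟩
    simp only at h
    rwa [show m - 1 - (m - 1 - k) = k by omega] at h
  · rw [coeff_eq_zero_of_natDegree_lt, coeff_eq_zero_of_natDegree_lt]
    · omega
    · have := natDegree_polyOfCoeffs_le (m := m) (fun s => p.coeff (m - 1 - s))
      omega

/-- By the binomial theorem, the numbers `d_{s+1,·}` in column `s` are the coefficients of
`(x+κ)^{m-1-s} - x^{m-1-s}`. -/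
theorem matA_mulVec (c : Fin m → ℝ) (r : Fin m) :
    (matA m κ *ᵥ c) r = if (r : ℕ) + 1 = m then (polyOfCoeffs m c).eval 0 else
      ((polyOfCoeffs m c).comp (X + C (κ : ℝ)) - polyOfCoeffs m c).coeff (m - 2 - r) := by
  rw [mulVec, dotProduct]
  split_ifs with h
  · rw [← coeff_zero_eq_eval_zero, show 0 = m - 1 - (r : ℕ) by omega, coeff_polyOfCoeffs,
      Finset.sum_eq_single r]
    · simp [matA, h]
    · intro s _ hs
      have : (s : ℕ) + 1 ≠ m := fun h' => hs (Fin.ext (by omega))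
      simp [matA, h, this]
    · simp
  · rw [polyOfCoeffs, sum_comp, ← Finset.sum_sub_distrib, finsetSum_coeff]
    refine Finset.sum_congr rfl fun s _ => ?_
    have hr := r.2
    have hs := s.2
    rw [mul_comp, C_comp, X_pow_comp, ← mul_sub, coeff_C_mul, coeff_sub, coeff_X_add_C_pow,
      coeff_X_pow, mul_comm, matA, of_apply, if_neg h]
    congr 1
    -- The subtracted monomial contributes only for `s = r + 1`, where it cancels the leading
    -- coefficient `1`; for larger `s` the binomial is zero.
    split_ifs with h1 h2 h2
    · omega
    · rw [dCoeff, sub_zero, mul_comm, show m - (s + 1) = m - 1 - (s : ℕ) by omega,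
        show m - (r + 1 - s) - (s + 1) = m - 2 - (r : ℕ) by omega,
        show m - 1 - (s : ℕ) - (m - 2 - r) = r + 1 - s by omega]
    · simp [h2]
    · rw [Nat.choose_eq_zero_of_lt (by omega)]
      simp

/-- Both sides of the difference equation have degree at most `m - 2`, so the first `m - 1` rows
compare all of their coefficients. -/
theorem matA_mulVec_eq_vecB_iff (hm : 2 ≤ m) {q : ℝ[X]} (hq : q.natDegree ≤ m - 2)
    (c : Fin m → ℝ) : matA m κ *ᵥ c = vecB m q ↔
      (polyOfCoeffs m c).comp (X + C (κ : ℝ)) - polyOfCoeffs m c = q ∧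
      (polyOfCoeffs m c).eval 0 = 1 := by
  constructor
  · intro h
    refine ⟨?_, ?_⟩
    · ext k
      by_cases hk : k ≤ m - 2
      · have h1 := congrFun h ⟨m - 2 - k, by omega⟩
        rw [matA_mulVec, vecB, if_neg (by simp only; omega), if_neg (by simp only; omega)] at h1
        simp only at h1
        rwa [show m - 2 - (m - 2 - k) = k by omega] at h1
      · have := natDegree_comp_X_add_C_sub_le (natDegree_polyOfCoeffs_le c) (κ : ℝ)
        rw [coeff_eq_zero_of_natDegree_lt, coeff_eq_zero_of_natDegree_lt] <;> omega
    · have h1 := congrFun h ⟨m - 1, by omega⟩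
      rwa [matA_mulVec, vecB, if_pos (by simp only; omega), if_pos (by simp only; omega)] at h1
  · rintro ⟨h1, h2⟩
    ext r
    rw [matA_mulVec, vecB, h1, h2]

theorem matB_mulVec (c : Fin m → ℝ) (r : Fin (κ - 1)) :
    (matB m κ *ᵥ c) r = (polyOfCoeffs m c).eval ((r : ℝ) + 1) := by
  rw [mulVec, dotProduct, polyOfCoeffs, eval_finsetSum]
  exact Finset.sum_congr rfl fun s _ => by
    rw [eval_C_mul, eval_pow, eval_X, mul_comm]
    rfl

/-- A kernel vector gives a `κ`-periodic polynomial vanishing at `0`, hence at all multiples of `κ`,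
hence identically. -/
theorem isUnit_matA (hm : 2 ≤ m) (hκ : 1 ≤ κ) : IsUnit (matA m κ) := by
  rw [← mulVec_injective_iff_isUnit]
  refine (injective_iff_map_eq_zero (matA m κ).mulVecLin).2 fun c hc => ?_
  have hc : matA m κ *ᵥ c = 0 := hc
  set p := polyOfCoeffs m c with hp
  have h0 : p.eval 0 = 0 := by
    have h1 := congrFun hc ⟨m - 1, by omega⟩
    rwa [matA_mulVec, if_pos (by simp only; omega)] at h1
  have hper : p.comp (X + C (κ : ℝ)) - p = 0 := by
    ext k
    by_cases hk : k ≤ m - 2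
    · have h1 := congrFun hc ⟨m - 2 - k, by omega⟩
      rw [matA_mulVec, if_neg (by simp only; omega)] at h1
      simp only at h1
      rwa [show m - 2 - (m - 2 - k) = k by omega] at h1
    · have := natDegree_comp_X_add_C_sub_le (natDegree_polyOfCoeffs_le c) (κ : ℝ)
      rw [coeff_eq_zero_of_natDegree_lt, coeff_zero]
      rw [hp]
      omega
  have hz : ∀ n : ℕ, p.eval ((n : ℝ) * κ) = 0 := by
    intro n
    induction n with
    | zero => simpa using h0
    | succ n ih =>
      have h1 := congrArg (Polynomial.eval ((n : ℝ) * κ)) hper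
      rw [eval_sub, eval_comp, ih, sub_zero, eval_add, eval_X, eval_C, eval_zero] at h1
      rw [← h1]
      push_cast
      ring_nf
  have hp0 : p = 0 := by
    refine eq_zero_of_infinite_isRoot p ((Set.infinite_range_of_injective
      (f := fun n : ℕ => (n : ℝ) * κ) fun a b hab => ?_).mono (by rintro _ ⟨n, rfl⟩; exact hz n))
    have hκ' : (κ : ℝ) ≠ 0 := by exact_mod_cast (show κ ≠ 0 by omega)
    exact Nat.cast_injective (mul_right_cancel₀ hκ' hab)
  ext s
  rw [← coeff_polyOfCoeffs c s, ← hp, hp0]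
  simp

end Matrices

/-! ### Rank of a bordered matrix -/

section Rank

open Matrix

variable {ι ι' : Type*} [Fintype ι] [DecidableEq ι] [Fintype ι']

theorem replicateCol_mulVec_unit {k : Type*} (w : k → ℝ) (t : Unit → ℝ) :
    replicateCol Unit w *ᵥ t = t () • w := by
  ext i
  simp [mulVec, dotProduct, mul_comm]

theorem rank_fromCols_replicateCol {A : Matrix ι ι ℝ} (hA : IsUnit A) (b : ι → ℝ) :
    (fromCols A (replicateCol Unit b)).rank = Fintype.card ι := by
  refine le_antisymm (rank_le_card_height _) ?_
  have h : fromCols A (replicateCol Unit b) *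
      fromRows (1 : Matrix ι ι ℝ) (0 : Matrix Unit ι ℝ) = A := by
    rw [fromCols_mul_fromRows, Matrix.mul_one, Matrix.mul_zero, add_zero]
  rw [← rank_of_isUnit A hA]
  conv_lhs => rw [← h]
  exact rank_mul_le_left _ _

/-- There is one column more than the rank, so rank-nullity gives a nonzero kernel vector `(c, t)`;
invertibility of `A` forces `t ≠ 0`, and rescaling solves both systems. Conversely, a common
solution factors the matrix through `[1 c]`, and the upper block already has full rank. -/
theorem rank_fromBlocks_replicateCol_iff {A : Matrix ι ι ℝ} (hA : IsUnit A) (b : ι → ℝ)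
    (B : Matrix ι' ι ℝ) (a : ι' → ℝ) :
    (fromBlocks A (replicateCol Unit b) B (replicateCol Unit a)).rank = Fintype.card ι ↔
      ∃ c : ι → ℝ, A *ᵥ c = b ∧ B *ᵥ c = a := by
  classical
  constructor
  · intro h
    set M := fromBlocks A (replicateCol Unit b) B (replicateCol Unit a) with hM
    have h1 := LinearMap.finrank_range_add_finrank_ker M.mulVecLin
    have h2 : Module.finrank ℝ (LinearMap.range M.mulVecLin) = Fintype.card ι := h
    rw [h2, Module.finrank_fintype_fun_eq_card, Fintype.card_sum, Fintype.card_unit] at h1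
    have h3 : 0 < Module.finrank ℝ (LinearMap.ker M.mulVecLin) := by omega
    obtain ⟨⟨x, hx⟩, hx0⟩ := Module.finrank_pos_iff_exists_ne_zero.1 h3
    have hx0 : x ≠ 0 := fun e => hx0 (Subtype.ext e)
    have hx : M *ᵥ x = 0 := hx
    obtain ⟨c, t, rfl⟩ : ∃ (c : ι → ℝ) (t : Unit → ℝ), x = Sum.elim c t :=
      ⟨x ∘ Sum.inl, x ∘ Sum.inr, (Sum.elim_comp_inl_inr x).symm⟩
    rw [hM, fromBlocks_mulVec] at hx
    have hx1 : A *ᵥ c + t () • b = 0 := by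
      rw [← replicateCol_mulVec_unit]
      ext i
      simpa using congrFun hx (Sum.inl i)
    have hx2 : B *ᵥ c + t () • a = 0 := by
      rw [← replicateCol_mulVec_unit]
      ext i
      simpa using congrFun hx (Sum.inr i)
    have ht : t () ≠ 0 := by
      intro ht
      rw [ht, zero_smul, add_zero] at hx1
      have hc : c = 0 := mulVec_injective_iff_isUnit.2 hA (hx1.trans (mulVec_zero A).symm)
      refine hx0 ?_
      ext (i | i)
      · simp [hc]
      · simpa using ht
    refine ⟨-(t ())⁻¹ • c, ?_, ?_⟩
    · rw [mulVec_smul, eq_neg_of_add_eq_zero_left hx1, neg_smul, smul_neg, neg_neg, smul_smul,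
        inv_mul_cancel₀ ht, one_smul]
    · rw [mulVec_smul, eq_neg_of_add_eq_zero_left hx2, neg_smul, smul_neg, neg_neg, smul_smul,
        inv_mul_cancel₀ ht, one_smul]
  · rintro ⟨c, rfl, rfl⟩
    refine le_antisymm ?_ ?_
    · have h : fromBlocks A (replicateCol Unit (A *ᵥ c)) B (replicateCol Unit (B *ᵥ c)) =
          fromRows A B * fromCols 1 (replicateCol Unit c) := by
        rw [fromRows_mul_fromCols, Matrix.mul_one, Matrix.mul_one, replicateCol_mulVec,
          replicateCol_mulVec]
      rw [h]
      exact (rank_mul_le_right _ _).trans (rank_le_card_height _)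
    · rw [← rank_fromCols_replicateCol hA (A *ᵥ c)]
      have h : fromCols A (replicateCol Unit (A *ᵥ c)) =
          fromCols (1 : Matrix ι ι ℝ) (0 : Matrix ι ι' ℝ) *
          fromBlocks A (replicateCol Unit (A *ᵥ c)) B (replicateCol Unit (B *ᵥ c)) := by
        rw [← fromRows_fromCols_eq_fromBlocks, fromCols_mul_fromRows, Matrix.one_mul,
          Matrix.zero_mul, add_zero]
      rw [h]
      exact rank_mul_le_right _ _

end Rank

/-! ### From `m`-isometry to polynomials and back -/

section Polynomials

theorem IsNormSqPoly.eq {X : Type*} {S : ℓ²(X, ℂ) →L[ℂ] ℓ²(X, ℂ)} {v : X} {p q : ℝ[X]}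
    (hp : IsNormSqPoly S v p) (hq : IsNormSqPoly S v q) : p = q :=
  polynomial_eq_of_eval_nat fun n => (hp n).trans (hq n).symm

theorem fwdDiff_iter_fiberMass {X : Type*} [MeasurableSpace X] {μ : Measure X} {T : X → X}
    (m n : ℕ) (u : X) :
    (fwdDiff 1)^[m] (fun k => fiberMass μ T k u) n = ∑ k ∈ Finset.range (m + 1),
      ((-1 : ℝ) ^ (m - k) * (m.choose k : ℝ)) * fiberMass μ T (n + k) u := by
  rw [fwdDiff_iter_eq_sum_shift]
  simp

variable {X : Type*} [Countable X] [MeasurableSpace X] [DiscreteMeasurableSpace X]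
  {μ : Measure X} {T : X → X}

theorem isNormSqPoly_iff (hμ : IsDiscreteMeasure μ) (hT : HasBoundedDeriv μ T) (v : X)
    (p : ℝ[X]) : IsNormSqPoly (weightedShift hμ hT) v p ↔
      ∀ n : ℕ, p.eval (n : ℝ) = fiberMass μ T n v / μ.real {v} := by
  simp only [IsNormSqPoly, norm_sq_pow_basisVec]

/-- For an `m`-isometric shift all the `m`-th differences of the masses vanish. -/
theorem IsMIsometric.fwdDiff_iter_fiberMass_eq_zero (hμ : IsDiscreteMeasure μ)
    (hT : HasBoundedDeriv μ T) {m : ℕ} (h : IsMIsometric m (weightedShift hμ hT)) (u : X) (n : ℕ) :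
    (fwdDiff 1)^[m] (fun k => fiberMass μ T k u) n = 0 := by
  rw [isMIsometric_weightedShift_iff] at h
  rw [fwdDiff_iter_fiberMass]
  -- The identity at each `w ∈ T⁻ⁿ{u}`, summed over this fibre, is the identity at `u` shifted by
  -- `n`.
  have h1 := hasSum_sum fun k (_ : k ∈ Finset.range (m + 1)) =>
    (hasSum_fiberMass hμ hT k n u).mul_left ((-1 : ℝ) ^ (m - k) * (m.choose k : ℝ))
  simp only [h] at h1
  simpa only [add_comm n] using h1.unique hasSum_zero

theorem isMIsometric_of_fwdDiff_iter_fiberMass_eq_zero (hμ : IsDiscreteMeasure μ)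
    (hT : HasBoundedDeriv μ T) {m : ℕ}
    (h : ∀ u n, (fwdDiff 1)^[m] (fun k => fiberMass μ T k u) n = 0) :
    IsMIsometric m (weightedShift hμ hT) := by
  rw [isMIsometric_weightedShift_iff]
  intro u
  have := h u 0
  rw [fwdDiff_iter_fiberMass] at this
  simpa using this

theorem IsMIsometric.exists_isNormSqPoly (hμ : IsDiscreteMeasure μ)
    (hT : HasBoundedDeriv μ T) {m : ℕ} (h : IsMIsometric m (weightedShift hμ hT)) (u : X) :
    ∃ p : ℝ[X], p.natDegree ≤ m - 1 ∧ IsNormSqPoly (weightedShift hμ hT) u p := by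
  obtain ⟨p, hp, hpe⟩ := exists_polynomial_of_fwdDiff_iter_eq_zero
    (h.fwdDiff_iter_fiberMass_eq_zero hμ hT u)
  refine ⟨p * Polynomial.C (μ.real {u})⁻¹, (Polynomial.natDegree_mul_C_le _ _).trans hp,
    (isNormSqPoly_iff hμ hT u _).2 fun n => ?_⟩
  rw [Polynomial.eval_mul, Polynomial.eval_C, hpe, div_eq_mul_inv]

theorem IsNormSqPoly.eval_mul_real (hμ : IsDiscreteMeasure μ)
    (hT : HasBoundedDeriv μ T) {u : X} {p : ℝ[X]}
    (h : IsNormSqPoly (weightedShift hμ hT) u p) (n : ℕ) :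
    μ.real {u} * p.eval (n : ℝ) = fiberMass μ T n u := by
  rw [(isNormSqPoly_iff hμ hT u p).1 h, mul_div_cancel₀ _ (hμ.real_pos u).ne']

theorem IsNormSqPoly.fwdDiff_iter_fiberMass_eq_zero (hμ : IsDiscreteMeasure μ)
    (hT : HasBoundedDeriv μ T) {m : ℕ} {u : X} {p : ℝ[X]} (hm : p.natDegree < m)
    (h : IsNormSqPoly (weightedShift hμ hT) u p) (n : ℕ) :
    (fwdDiff 1)^[m] (fun k => fiberMass μ T k u) n = 0 := by
  have h1 : (fun k => fiberMass μ T k u) = μ.real {u} • fun k : ℕ => p.eval (k : ℝ) :=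
    funext fun k => (h.eval_mul_real hμ hT k).symm
  rw [h1, fwdDiff_iter_const_smul, Pi.smul_apply, fwdDiff_iter_eval_eq_zero hm, smul_zero]

/-- The masses of disjoint sets `T⁻ⁿ{u}` and `T⁻ⁿ{v}` contained in `T⁻⁽ⁿ⁺ᵏ⁾{w}`. -/
theorem fiberMass_add_le (hμ : IsDiscreteMeasure μ) (hT : HasBoundedDeriv μ T) (n k : ℕ)
    {u v w : X} (huv : u ≠ v) (hu : T^[k] u = w) (hv : T^[k] v = w) :
    fiberMass μ T n u + fiberMass μ T n v ≤ fiberMass μ T (n + k) w := by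
  classical
  have h := sum_le_hasSum {(⟨u, hu⟩ : {x // T^[k] x = w}), ⟨v, hv⟩}
    (fun _ _ => fiberMass_nonneg n _) (hasSum_fiberMass hμ hT n k w)
  rwa [Finset.sum_pair (fun e => huv (congrArg Subtype.val e))] at h

end Polynomials

/-! ### The difference equation at `v₀` and the rank condition -/

namespace OneCycleGraph

theorem IsCyclePoly.eq {X : Type*} [MeasurableSpace X] {μ : Measure X} {T : X → X} {κ d : ℕ}
    {G : OneCycleGraph T κ} {p : G.OffCycle → ℝ[X]} {q q' : ℝ[X]}
    (h : G.IsCyclePoly μ d p q) (h' : G.IsCyclePoly μ d p q') : q = q' :=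
  Polynomial.funext fun x => (h.2 x).2.trans (h'.2 x).2.symm

theorem rankCondition_iff {X : Type*} {T : X → X} {κ : ℕ} (G : OneCycleGraph T κ)
    {q : ℝ[X]} {m : ℕ} (hm : 2 ≤ m) (S : ℓ²(X, ℂ) →L[ℂ] ℓ²(X, ℂ)) :
    RankCondition G S m q ↔ ∃ c, (matA m κ).mulVec c = vecB m q ∧
      (matB m κ).mulVec c = vecA κ S (G.vMod 0) := by
  have hU := isUnit_matA hm G.κ_pos
  have h1 := rank_fromCols_replicateCol hU (vecB m q)
  have h2 := rank_fromBlocks_replicateCol_iff hU (vecB m q) (matB m κ) (vecA κ S (G.vMod 0))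
  rw [Fintype.card_fin] at h1 h2
  rw [RankCondition, matATilde, matBTilde, h2]
  exact and_iff_right h1

variable {X : Type*} [Countable X] [MeasurableSpace X] [DiscreteMeasurableSpace X]
  {μ : Measure X} {T : X → X} {κ : ℕ} (G : OneCycleGraph T κ)

/-- Off the cycle the degree drops. -/
theorem exists_isNormSqPoly_offCycle (hμ : IsDiscreteMeasure μ) (hT : HasBoundedDeriv μ T)
    (hconn : Connected (selfMapGraph T)) {m : ℕ}
    (h : IsMIsometric m (weightedShift hμ hT)) (v : G.OffCycle) :
    ∃ p : ℝ[X], p.natDegree ≤ m - 2 ∧ IsNormSqPoly (weightedShift hμ hT) v p := by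
  obtain ⟨p, _, hp⟩ := h.exists_isNormSqPoly hμ hT v
  refine ⟨p, ?_, hp⟩
  obtain ⟨k, j, hk⟩ := G.exists_iterate_mul_eq_vMod hconn v
  obtain ⟨r, hr, hrp⟩ := h.exists_isNormSqPoly hμ hT (G.vMod j)
  have hcyc : T^[k * κ] (G.vMod j) = G.vMod j := by
    conv_lhs => rw [← G.vMod_add_mul j k]
    exact G.iterate_vMod_add (k * κ) j
  have hne : G.vMod j ≠ v := fun e => v.2 (e ▸ G.vMod_mem_range j)
  have ha := hμ.real_pos (v : X)
  have hb := hμ.real_pos (G.vMod j)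
  have hdeg := natDegree_comp_X_add_C_sub_le hr ((k * κ : ℕ) : ℝ)
  set d := r.comp (Polynomial.X + Polynomial.C ((k * κ : ℕ) : ℝ)) - r with hd
  -- Disjointness of the fibres over `v_j` and `v` bounds `p` by a multiple of `r(x + kκ) - r(x)`,
  -- whose degree is at most `m - 2`.
  have hle : p.natDegree ≤
      (Polynomial.C (μ.real {G.vMod j} / μ.real {(v : X)}) * d).natDegree := by
    refine natDegree_le_of_eval_nat_le (fun n => ?_) fun n => ?_
    · rw [hp n]
      positivity
    · have h1 := fiberMass_add_le hμ hT n (k * κ) hne hcyc hk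
      rw [← hrp.eval_mul_real hμ hT, ← hrp.eval_mul_real hμ hT, ← hp.eval_mul_real hμ hT] at h1
      rw [Polynomial.eval_C_mul, hd, Polynomial.eval_sub, Polynomial.eval_comp,
        Polynomial.eval_add, Polynomial.eval_X, Polynomial.eval_C, ← Nat.cast_add,
        div_mul_eq_mul_div, le_div_iff₀ ha]
      linarith
  have := hle.trans ((Polynomial.natDegree_C_mul_le _ _).trans hdeg)
  omega

section CyclePoly

variable {d : ℕ} {p : G.OffCycle → ℝ[X]}

/-- Since `i < κ`, the argument `n + κ - i - 1` is a natural number, so the polynomials return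
actual masses there. -/
theorem hasSum_eval_root (hμ : IsDiscreteMeasure μ) (hT : HasBoundedDeriv μ T)
    (hp : G.IsOffCycleFamily (weightedShift hμ hT) d p) (i : Fin κ) (n : ℕ) :
    HasSum (fun R : {R : G.trees // G.idx R = i} =>
      weight μ T (G.root R) ^ 2 * (p (G.rootOff R)).eval ((n : ℝ) + κ - i - 1))
      (G.rootMass μ i (n + κ - i - 1) / μ.real {G.vMod i}) := by
  have hi : G.modIdx i = i := Fin.ext (Nat.mod_eq_of_lt i.2)
  have h := (G.hasSum_rootMass hμ hT i (n + κ - i - 1)).div_const (μ.real {G.vMod i})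
  rw [hi] at h
  refine h.congr_fun fun R => ?_
  have hR := (hp (G.rootOff R)).2.eval_mul_real hμ hT (n + κ - i - 1)
  have hcast : ((n + κ - i - 1 : ℕ) : ℝ) = (n : ℝ) + κ - i - 1 := by
    have := i.2
    rw [Nat.cast_sub (by omega), Nat.cast_sub (by omega)]
    push_cast
    ring
  rw [hcast] at hR
  change μ.real {(G.root R : X)} * _ = fiberMass μ T _ (G.root R : X) at hR
  rw [weight_sq, G.map_root, R.2, ← G.vMod_coe, ← hR]
  ring

/-- The formula for `q` defines a polynomial. -/
theorem exists_isCyclePoly (hμ : IsDiscreteMeasure μ) (hT : HasBoundedDeriv μ T)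
    (hp : G.IsOffCycleFamily (weightedShift hμ hT) d p) : ∃ q, G.IsCyclePoly μ d p q := by
  have key : ∀ i : Fin κ, ∃ q : ℝ[X], q.natDegree ≤ d ∧ ∀ x : ℝ,
      HasSum (fun R : {R : G.trees // G.idx R = i} =>
        weight μ T (G.root R) ^ 2 * (p (G.rootOff R)).eval (x + κ - i - 1)) (q.eval x) := by
    intro i
    have hev : ∀ (R : {R : G.trees // G.idx R = i}) (x : ℝ),
        (Polynomial.C (weight μ T (G.root R) ^ 2) * (p (G.rootOff R)).comp
          (Polynomial.X + Polynomial.C ((κ : ℝ) - i - 1))).eval x =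
        weight μ T (G.root R) ^ 2 * (p (G.rootOff R)).eval (x + κ - i - 1) := fun R x => by
      rw [Polynomial.eval_C_mul, Polynomial.eval_comp, Polynomial.eval_add, Polynomial.eval_X,
        Polynomial.eval_C]
      ring_nf
    obtain ⟨q, hq, hqs⟩ := hasSum_eval_of_hasSum_eval_nat (d := d)
      (p := fun R : {R : G.trees // G.idx R = i} => Polynomial.C (weight μ T (G.root R) ^ 2) *
        (p (G.rootOff R)).comp (Polynomial.X + Polynomial.C ((κ : ℝ) - i - 1)))
      (fun R => (Polynomial.natDegree_C_mul_le _ _).trans (by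
        rw [← Polynomial.taylor_apply, Polynomial.natDegree_taylor]
        exact (hp _).1))
      (s := fun n => G.rootMass μ i (n + κ - i - 1) / μ.real {G.vMod i})
      (fun n _ => by
        simp only [hev]
        exact G.hasSum_eval_root hμ hT hp i n)
    simp only [hev] at hqs
    exact ⟨q, hq, hqs⟩
  choose q hq hqs using key
  refine ⟨∑ i : Fin κ, Polynomial.C (G.bigLambda μ 0 i ^ 2) * q i,
    Polynomial.natDegree_sum_le_of_forall_le _ _ fun i _ =>
      (Polynomial.natDegree_C_mul_le _ _).trans (hq i), fun x => ⟨fun i => (hqs i x).summable, ?_⟩⟩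
  rw [Polynomial.eval_finsetSum]
  exact Finset.sum_congr rfl fun i _ => by rw [Polynomial.eval_C_mul, (hqs i x).tsum_eq]

/-- The factor `Λ_{0,i}²` telescopes to `μ{v_i} / μ{v_0}`, which turns the formula for `q` into the
mass collected in one full turn. -/
theorem IsCyclePoly.eval_nat {G : OneCycleGraph T κ} {p : G.OffCycle → ℝ[X]} {q : ℝ[X]}
    (hμ : IsDiscreteMeasure μ) (hT : HasBoundedDeriv μ T)
    (hp : G.IsOffCycleFamily (weightedShift hμ hT) d p) (h : G.IsCyclePoly μ d p q) (n : ℕ) :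
    q.eval (n : ℝ) = fiberMass μ T (n + κ) (G.vMod 0) / μ.real {G.vMod 0} -
      fiberMass μ T n (G.vMod 0) / μ.real {G.vMod 0} := by
  rw [(h.2 n).2, ← sub_div, G.fiberMass_add_period hμ hT, add_sub_cancel_left, Finset.sum_div,
    ← Fin.sum_univ_eq_sum_range (fun l => G.rootMass μ l (n + κ - l - 1) / μ.real {G.vMod 0})]
  refine Finset.sum_congr rfl fun i _ => ?_
  rw [(G.hasSum_eval_root hμ hT hp i n).tsum_eq, bigLambda_zero_sq G hμ, div_mul_div_comm,
    mul_comm, mul_div_mul_right _ _ (hμ.real_pos _).ne']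

/-- Both sides obey the same recurrence of step `κ`. The last row of `A` gives the value at `0`, and
`B` gives those at `1, …, κ - 1`; for `κ = 1` there are none to prescribe. -/
theorem isNormSqPoly_polyOfCoeffs {q : ℝ[X]} {m : ℕ} (hm : 2 ≤ m)
    (hμ : IsDiscreteMeasure μ) (hT : HasBoundedDeriv μ T)
    (hp : G.IsOffCycleFamily (weightedShift hμ hT) (m - 2) p) (hq : G.IsCyclePoly μ (m - 2) p q)
    {c : Fin m → ℝ} (hA : (matA m κ).mulVec c = vecB m q)
    (hB : 1 < κ → (matB m κ).mulVec c = vecA κ (weightedShift hμ hT) (G.vMod 0)) :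
    IsNormSqPoly (weightedShift hμ hT) (G.vMod 0) (polyOfCoeffs m c) := by
  obtain ⟨h1, h2⟩ := (matA_mulVec_eq_vecB_iff hm hq.1 c).1 hA
  have hκ := G.κ_pos
  intro n
  induction n using Nat.strong_induction_on with
  | _ n ih =>
    rcases lt_or_ge n κ with hn | hn
    · rcases n with _ | n
      · rw [Nat.cast_zero, h2, norm_sq_pow_basisVec, fiberMass_zero,
          div_self (hμ.real_pos _).ne']
      · have h3 := congrFun (hB (by omega)) ⟨n, by omega⟩
        rw [matB_mulVec] at h3
        rw [Nat.cast_succ]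
        exact h3
    · obtain ⟨l, rfl⟩ := Nat.exists_eq_add_of_le' hn
      have h3 := hq.eval_nat hμ hT hp l
      rw [← h1, Polynomial.eval_sub, Polynomial.eval_comp, Polynomial.eval_add, Polynomial.eval_X,
        Polynomial.eval_C, ← norm_sq_pow_basisVec hμ hT, ← norm_sq_pow_basisVec hμ hT,
        ih l (by omega)] at h3
      rw [Nat.cast_add]
      linarith

theorem existsUnique_coeffs {q : ℝ[X]} {m : ℕ} (hm : 2 ≤ m)
    (hμ : IsDiscreteMeasure μ) (hT : HasBoundedDeriv μ T)
    (hp : G.IsOffCycleFamily (weightedShift hμ hT) (m - 2) p) (hq : G.IsCyclePoly μ (m - 2) p q)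
    (hr : 1 < κ → RankCondition G (weightedShift hμ hT) m q) :
    ∃ c : Fin m → ℝ, (matA m κ).mulVec c = vecB m q ∧
      (∀ c' : Fin m → ℝ, (matA m κ).mulVec c' = vecB m q → c' = c) ∧
      IsNormSqPoly (weightedShift hμ hT) (G.vMod 0) (polyOfCoeffs m c) := by
  have hU := isUnit_matA hm G.κ_pos
  have hinj := Matrix.mulVec_injective_iff_isUnit.2 hU
  obtain ⟨c, hc⟩ := Matrix.mulVec_surjective_iff_isUnit.2 hU (vecB m q)
  refine ⟨c, hc, fun c' hc' => hinj (hc'.trans hc.symm),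
    G.isNormSqPoly_polyOfCoeffs hm hμ hT hp hq hc fun hκ => ?_⟩
  -- The solution supplied by the rank condition is `c` itself, as `A` is injective.
  obtain ⟨c', hA, hB⟩ := (G.rankCondition_iff hm _).1 (hr hκ)
  rwa [← hinj (hA.trans hc.symm)]

theorem rankCondition_of_isMIsometric {q : ℝ[X]} {m : ℕ} (hm : 2 ≤ m)
    (hμ : IsDiscreteMeasure μ) (hT : HasBoundedDeriv μ T)
    (hp : G.IsOffCycleFamily (weightedShift hμ hT) (m - 2) p) (hq : G.IsCyclePoly μ (m - 2) p q)
    (h : IsMIsometric m (weightedShift hμ hT)) : RankCondition G (weightedShift hμ hT) m q := by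
  obtain ⟨r, hr, hrp⟩ := h.exists_isNormSqPoly hμ hT (G.vMod 0)
  -- The common solution is the coefficient vector of the polynomial of `v₀`.
  refine (G.rankCondition_iff hm _).2 ⟨fun s => r.coeff (m - 1 - s), ?_, ?_⟩
  · rw [matA_mulVec_eq_vecB_iff hm hq.1, polyOfCoeffs_coeff (by omega) hr]
    constructor
    · refine polynomial_eq_of_eval_nat fun n => ?_
      rw [hq.eval_nat hμ hT hp, Polynomial.eval_sub, Polynomial.eval_comp, Polynomial.eval_add,
        Polynomial.eval_X, Polynomial.eval_C, ← Nat.cast_add, hrp, hrp, norm_sq_pow_basisVec,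
        norm_sq_pow_basisVec]
    · have h0 := hrp 0
      rwa [Nat.cast_zero, norm_sq_pow_basisVec, fiberMass_zero,
        div_self (hμ.real_pos _).ne'] at h0
  · ext i
    rw [matB_mulVec, polyOfCoeffs_coeff (by omega) hr, vecA, ← hrp, Nat.cast_succ]

/-- Differences of the masses vanish along the cycle if they do so at `v₀` and off the cycle. -/
theorem fwdDiff_iter_fiberMass_vMod_eq_zero (hμ : IsDiscreteMeasure μ)
    (hT : HasBoundedDeriv μ T) {m : ℕ}
    (hoff : ∀ (v : G.OffCycle) (n : ℕ),
      (fwdDiff 1)^[m] (fun k => fiberMass μ T k (v : X)) n = 0)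
    (h0 : ∀ n, (fwdDiff 1)^[m] (fun k => fiberMass μ T k (G.vMod 0)) n = 0) (j n : ℕ) :
    (fwdDiff 1)^[m] (fun k => fiberMass μ T k (G.vMod j)) n = 0 := by
  induction j generalizing n with
  | zero => exact h0 n
  | succ j ih =>
    have hroot : ∑ k ∈ Finset.range (m + 1),
        ((-1 : ℝ) ^ (m - k) * (m.choose k : ℝ)) * G.rootMass μ j (n + k) = 0 := by
      have h1 := hasSum_sum fun k (_ : k ∈ Finset.range (m + 1)) =>
        (G.hasSum_rootMass hμ hT j (n + k)).mul_left ((-1 : ℝ) ^ (m - k) * (m.choose k : ℝ))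
      refine h1.unique (hasSum_zero.congr_fun fun R => ?_)
      rw [← fwdDiff_iter_fiberMass]
      exact hoff (G.rootOff R) n
    -- The masses over `v_j` at `n + 1` are those over `v_{j+1}` at `n` plus the root masses, whose
    -- differences vanish.
    have h2 := ih (n + 1)
    rw [fwdDiff_iter_fiberMass] at h2 ⊢
    simp only [add_right_comm n 1, G.fiberMass_succ_vMod hμ hT, mul_add, Finset.sum_add_distrib,
      hroot, add_zero] at h2
    exact h2

theorem isMIsometric_of_isNormSqPoly {m : ℕ} (hm : 2 ≤ m)
    (hμ : IsDiscreteMeasure μ) (hT : HasBoundedDeriv μ T)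
    (hp : G.IsOffCycleFamily (weightedShift hμ hT) (m - 2) p) {r : ℝ[X]}
    (hr : r.natDegree ≤ m - 1) (hrp : IsNormSqPoly (weightedShift hμ hT) (G.vMod 0) r) :
    IsMIsometric m (weightedShift hμ hT) := by
  have hoff : ∀ (v : G.OffCycle) (n : ℕ),
      (fwdDiff 1)^[m] (fun k => fiberMass μ T k (v : X)) n = 0 := fun v n =>
    (hp v).2.fwdDiff_iter_fiberMass_eq_zero hμ hT (by have := (hp v).1; omega) n
  refine isMIsometric_of_fwdDiff_iter_fiberMass_eq_zero hμ hT fun u n => ?_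
  by_cases hu : u ∈ Set.range G.v
  · obtain ⟨i, rfl⟩ := hu
    rw [← G.vMod_coe]
    exact G.fwdDiff_iter_fiberMass_vMod_eq_zero hμ hT hoff
      (hrp.fwdDiff_iter_fiberMass_eq_zero hμ hT (by omega)) i n
  · exact hoff ⟨u, hu⟩ n

end CyclePoly

end OneCycleGraph

end CompOp

/-! ### The theorem -/

theorem mainTheorem2 {X : Type*} [Countable X] [MeasurableSpace X] [DiscreteMeasurableSpace X]
    (μ : Measure X) (hμ : CompOp.IsDiscreteMeasure μ)
    (T : X → X) (hT : CompOp.HasBoundedDeriv μ T)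
    (hconn : CompOp.Connected (CompOp.selfMapGraph T))
    (κ : ℕ) (G : CompOp.OneCycleGraph T κ)
    (m : ℕ) (hm : 2 ≤ m) :
    -- the formula for `q` defines exactly one polynomial of degree at most `m - 2`
    (∀ p : G.OffCycle → ℝ[X],
      G.IsOffCycleFamily (CompOp.weightedShift hμ hT) (m - 2) p →
        ∃! q : ℝ[X], G.IsCyclePoly μ (m - 2) p q) ∧
    -- the equivalence
    (CompOp.IsMIsometric m (CompOp.weightedShift hμ hT) ↔
      (∀ v : G.OffCycle, ∃! p : ℝ[X],
        p.natDegree ≤ m - 2 ∧ CompOp.IsNormSqPoly (CompOp.weightedShift hμ hT) v p) ∧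
      (1 < κ → ∃ (p : G.OffCycle → ℝ[X]) (q : ℝ[X]),
        G.IsOffCycleFamily (CompOp.weightedShift hμ hT) (m - 2) p ∧
        G.IsCyclePoly μ (m - 2) p q ∧
        CompOp.RankCondition G (CompOp.weightedShift hμ hT) m q)) ∧
    -- the polynomial of the vertex `v₀`
    (∀ (p : G.OffCycle → ℝ[X]) (q : ℝ[X]),
      G.IsOffCycleFamily (CompOp.weightedShift hμ hT) (m - 2) p →
      G.IsCyclePoly μ (m - 2) p q →
      (1 < κ → CompOp.RankCondition G (CompOp.weightedShift hμ hT) m q) →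
      ∃ c : Fin m → ℝ, (CompOp.matA m κ).mulVec c = CompOp.vecB m q ∧
        (∀ c' : Fin m → ℝ, (CompOp.matA m κ).mulVec c' = CompOp.vecB m q → c' = c) ∧
        CompOp.IsNormSqPoly (CompOp.weightedShift hμ hT) (G.vMod 0)
          (CompOp.polyOfCoeffs m c)) := by
  have hcyc : ∀ p : G.OffCycle → ℝ[X],
      G.IsOffCycleFamily (CompOp.weightedShift hμ hT) (m - 2) p →
        ∃! q : ℝ[X], G.IsCyclePoly μ (m - 2) p q := fun p hp => by
    obtain ⟨q, hq⟩ := G.exists_isCyclePoly hμ hT hp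
    exact ⟨q, hq, fun q' hq' => hq'.eq hq⟩
  have hcoeff := fun (p : G.OffCycle → ℝ[X]) (q : ℝ[X]) hp hq hr =>
    G.existsUnique_coeffs (p := p) (q := q) hm hμ hT hp hq hr
  refine ⟨hcyc, ⟨fun h => ?_, ?_⟩, hcoeff⟩
  · have hex := G.exists_isNormSqPoly_offCycle hμ hT hconn h
    refine ⟨fun v => ?_, fun _ => ?_⟩
    · obtain ⟨p, hp, hpn⟩ := hex v
      exact ⟨p, ⟨hp, hpn⟩, fun p' hp' => hp'.2.eq hpn⟩
    · choose p hp using hex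
      obtain ⟨q, hq⟩ := G.exists_isCyclePoly hμ hT hp
      exact ⟨p, q, hp, hq, G.rankCondition_of_isMIsometric hm hμ hT hp hq h⟩
  · rintro ⟨hoff, hrank⟩
    obtain ⟨p, q, hp, hq, hr⟩ : ∃ (p : G.OffCycle → ℝ[X]) (q : ℝ[X]),
        G.IsOffCycleFamily (CompOp.weightedShift hμ hT) (m - 2) p ∧
        G.IsCyclePoly μ (m - 2) p q ∧
        (1 < κ → CompOp.RankCondition G (CompOp.weightedShift hμ hT) m q) := by
      -- For `κ = 1` the hypothesis supplies no `p` and `q`; they are built from the off-cycle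
      -- polynomials, and the rank requirement is vacuous.
      by_cases hκ : 1 < κ
      · obtain ⟨p, q, hp, hq, hr⟩ := hrank hκ
        exact ⟨p, q, hp, hq, fun _ => hr⟩
      · choose p hp using fun v => (hoff v).exists
        obtain ⟨q, hq⟩ := G.exists_isCyclePoly hμ hT hp
        exact ⟨p, q, hp, hq, fun h => absurd h hκ⟩
    obtain ⟨c, _, _, hc⟩ := hcoeff p q hp hq hr
    exact G.isMIsometric_of_isNormSqPoly hm hμ hT hp (CompOp.natDegree_polyOfCoeffs_le c) hc
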